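/- Let $p_1,p_2,p_3$ and $1\le r_k\le p_k$ ($k=1,2,3$) be positive integers, $p=\min\{p_1,p_2,p_3\}$, and $\sigma>0$. Consider the model $\mathbf Y=\mathbf X+\mathbf Z\in\mathbb R^{p_1\times p_2\times p_3}$, where $\mathbf Z$ has i.i.d. $N(0,\sigma^2)$ entries and $\mathbf X=\mathbf S\times_1U_1\times_2U_2\times_3U_3$, i.e. $X_{ijk}=\sum_{i',j',k'}S_{i'j'k'}(U_1)_{ii'}(U_2)_{jj'}(U_3)_{kk'}$, is a fixed tensor with $\mathbf S\in\mathbb R^{r_1\times r_2\times r_3}$ and $U_k\in\mathbb O_{p_k,r_k}=\{V\in\mathbb R^{p_k\times r_k}:V^\top V=I_{r_k}\}$. Let $\lambda=\min_{k}\sigma_{r_k}(\mathcal M_k(\mathbf X))$, where $\mathcal M_k(\mathbf X)$ is the mode-$k$ matricization (the $p_k$-row matrix whose columns are the mode-$k$ fibers of $\mathbf X$) and $\sigma_j(\cdot)$ is the $j$-th largest singular value. The maximum likelihood estimator is any (measurable) choice of $$(\hat U_1,\hat U_2,\hat U_3)\in\mathop{\rm arg\,max}_{V_k\in\mathbb O_{p_k,r_k}}\big\|\mathbf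 Y\times_1V_1^\top\times_2V_2^\top\times_3V_3^\top\big\|_{\rm F}^2,\qquad \hat{\mathbf X}=\mathbf Y\times_1\hat U_1\hat U_1^\top\times_2\hat U_2\hat U_2^\top\times_3\hat U_3\hat U_3^\top$$ (so $\hat{\mathbf X}$ is a best approximation of $\mathbf Y$ in Frobenius norm by tensors of Tucker rank at most $(r_1,r_2,r_3)$). For $U,V\in\mathbb O_{m,r}$ let $\|\sin\Theta(V,U)\|_q=\big(\sum_{i=1}^r(1-s_i^2)^{q/2}\big)^{1/q}$, where $s_1,\dots,s_r$ are the singular values of $U^\top V$. For all constants $C_0,c_0>0$ there are constants $C_{gap}>0$ and $C>0$, depending only on $C_0$ and $c_0$ (not on $p_k,r_k,\lambda,\sigma,q$), such that the following holds. If for $k=1,2,3$ $$p_k\le C_0p,\quad r_k\le C_0p^{1/2},\quad \|\mathbf X\|_{\rm F}\le C_0\sigma\exp(c_0p),\quad \max\{r_1,r_2,r_3\}\le C_0\min\{r_1,r_2,r_3\},$$ and $\lambda/\sigma\ge C_{gap}\,p^{1/2}$, then $$\mathbb E\, r_k^{-1/q}\big\|\sin\Theta(\hat U_k,U_k)\big\|_q\le\frac{C\sqrt{p_k}}{\lambda/\sigma},\qquad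 k=1,2,3,\ 1\le q\le 2,$$ $$\mathbb E\big\|\hat{\mathbf X}-\mathbf X\big\|_{\rm F}^2\le C\sigma^2(p_1r_1+p_2r_2+p_3r_3),\qquad \mathbb E\frac{\|\hat{\mathbf X}-\mathbf X\|_{\rm F}^2}{\|\mathbf X\|_{\rm F}^2}\le C\left(\frac{p_1+p_2+p_3}{\lambda^2/\sigma^2}\wedge 1\right).$$ -/

import Mathlib

open MeasureTheory ProbabilityTheory
open scoped Matrix

namespace TensorSVD

/-- Real order-three tensors of size `p 0 × p 1 × p 2`; an entry is addressed by a multi-index. -/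
abbrev Tensor (p : Fin 3 → ℕ) : Type := (∀ k, Fin (p k)) → ℝ

/-- Triples of matrices, the `k`-th one being `p k × r k`. -/
abbrev Factors (p r : Fin 3 → ℕ) : Type := ∀ k, Matrix (Fin (p k)) (Fin (r k)) ℝ

/-- The smallest entry of a triplet. -/
def minOf (p : Fin 3 → ℕ) : ℕ := min (p 0) (min (p 1) (p 2))

/-- The largest entry of a triplet. -/
def maxOf (p : Fin 3 → ℕ) : ℕ := max (p 0) (max (p 1) (p 2))

/-- The tensor Frobenius norm. -/
noncomputable def frob {p : Fin 3 → ℕ} (X : Tensor p) : ℝ := √(∑ i, X i ^ 2)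

/-- Multiplication along all three modes, `X ×₁ A₁ ×₂ A₂ ×₃ A₃`, with entries
`∑_{i'j'k'} X_{i'j'k'} (A₁)_{ii'} (A₂)_{jj'} (A₃)_{kk'}`. -/
noncomputable def mulModes {p q : Fin 3 → ℕ} (X : Tensor p) (A : Factors q p) : Tensor q :=
  fun i => ∑ i', X i' * ∏ k, A k (i k) (i' k)

/-- The mode-`k` matricization: rows are indexed by the `k`-th index, columns by the pair of the
other two indices (the columns are the mode-`k` fibers). -/
def matricize {p : Fin 3 → ℕ} (k : Fin 3) (X : Tensor p) :
    Matrix (Fin (p k)) (∀ j : {j // j ≠ k}, Fin (p j)) ℝ :=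
  Matrix.of fun i c => X ((Equiv.piSplitAt k fun j => Fin (p j)).symm (i, c))

/-- Singular values in non-increasing order, extended by zeros; the index starts at `0`, so
`singVal A 0` is the largest one. -/
noncomputable def singVal {m n : Type*} [Fintype m] [Fintype n] [DecidableEq n]
    (A : Matrix m n ℝ) (i : ℕ) : ℝ :=
  (Matrix.toEuclideanLin A).singularValues i

/-- The signal strength `min_k σ_{r_k}(M_k(X))`, with `σ_{r_k}` the `r_k`-th largest singular
value (`r_k ≥ 1`). -/
noncomputable def signal {p : Fin 3 → ℕ} (r : Fin 3 → ℕ) (X : Tensor p) : ℝ :=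
  min (singVal (matricize 0 X) (r 0 - 1))
    (min (singVal (matricize 1 X) (r 1 - 1)) (singVal (matricize 2 X) (r 2 - 1)))

/-- Each matrix of the triple has orthonormal columns. -/
def Orthonormals {p r : Fin 3 → ℕ} (U : Factors p r) : Prop := ∀ k, (U k)ᵀ * U k = 1

/-- The Schatten `q`-`sin Θ` norm, `(∑ᵢ sin (arccos σᵢ) ^ q) ^ (1 / q)`, where the `σᵢ` are the
singular values of `Uᵀ V`. -/
noncomputable def sinTheta {p r : ℕ} (q : ℝ) (V U : Matrix (Fin p) (Fin r) ℝ) : ℝ :=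
  (∑ i : Fin r, Real.sin (Real.arccos (singVal (Uᵀ * V) i)) ^ q) ^ (1 / q)

/-- `V` is a maximum likelihood estimate of the loadings from the observation `Y`: it maximizes
`‖Y ×₁ W₁ᵀ ×₂ W₂ᵀ ×₃ W₃ᵀ‖_F²` over all triples `W` with orthonormal columns. -/
def IsMLE {p r : Fin 3 → ℕ} (Y : Tensor p) (V : Factors p r) : Prop :=
  Orthonormals V ∧ ∀ W : Factors p r, Orthonormals W →
    frob (mulModes Y fun k => (W k)ᵀ) ^ 2 ≤ frob (mulModes Y fun k => (V k)ᵀ) ^ 2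

/-- `Y ×₁ P₁ ×₂ P₂ ×₃ P₃`, where `P_k = V_k V_kᵀ` is the orthogonal projection onto the column
space of `V_k` (for `V_k` with orthonormal columns). -/
noncomputable def projectTensor {p r : Fin 3 → ℕ} (Y : Tensor p) (V : Factors p r) : Tensor p :=
  mulModes Y fun k => V k * (V k)ᵀ

end TensorSVD

open TensorSVD

/-! The argument is deterministic apart from one Gaussian maximum. By Pythagoras the maximum
likelihood estimator is a least-squares fit, so comparing it with the truth X gives, for the error D
= X̂ − X, the basic inequality ‖D‖² ≤ 2⟨Z, D⟩. In each mode D lives in the span of the columns of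
V_k and U_k, so its multilinear rank is at most 2r_k, and ‖D‖ is at most twice the supremum of ⟨Z,
T⟩ over such tensors T of norm at most one.

A net (`exists_tensor_net`) reduces this supremum, up to a factor 16, to a maximum of 5^(8r₁r₂r₃ +
2∑p_k r_k) Gaussians, whose second moment is of order σ² times the exponent
(`exists_integrable_sq_bound`). Since r_k ≤ C₀√p, the core term r₁r₂r₃ is absorbed by ∑p_k r_k,
which gives the mean squared error.

The other two bounds follow from it. The projection 1 − V_kV_kᵀ annihilates the matricization of X̂,
so it maps that of X to minus its image of that of D, while λ bounds its action on X below by λ‖(1 −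
V_kV_kᵀ)U_k‖_F. Hence ‖sin Θ‖₂ ≤ ‖D‖/λ, and power means cover q ≤ 2. For the relative error, ‖X‖² ≥
λ²r_k in every mode. -/

namespace TensorSVD

open Finset

variable {p q s : Fin 3 → ℕ}

/-! ### Algebra of multilinear multiplication -/

/-- The Kronecker product of a triple of matrices, acting on vectorized tensors. -/
def kron (A : Factors q p) : Matrix (∀ k, Fin (q k)) (∀ k, Fin (p k)) ℝ :=
  Matrix.of fun i i' => ∏ k, A k (i k) (i' k)

theorem mulModes_eq_mulVec (X : Tensor p) (A : Factors q p) : mulModes X A = kron A *ᵥ X := by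
  ext i
  simp only [mulModes, kron, Matrix.mulVec, dotProduct, Matrix.of_apply]
  exact sum_congr rfl fun _ _ => mul_comm _ _

theorem kron_mul (A : Factors s q) (B : Factors q p) :
    kron (fun k => A k * B k) = kron A * kron B := by
  ext i j
  simp only [kron, Matrix.of_apply, Matrix.mul_apply, ← prod_mul_distrib]
  rw [prod_univ_sum, Fintype.piFinset_univ]

theorem kron_transpose (A : Factors q p) : (kron A)ᵀ = kron fun k => (A k)ᵀ := rfl

theorem mulModes_mulModes (X : Tensor p) (A : Factors q p) (B : Factors s q) :
    mulModes (mulModes X A) B = mulModes X fun k => B k * A k := by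
  simp only [mulModes_eq_mulVec, kron_mul, Matrix.mulVec_mulVec]

theorem mulModes_sub (X Y : Tensor p) (A : Factors q p) :
    mulModes (X - Y) A = mulModes X A - mulModes Y A := by
  simp only [mulModes_eq_mulVec, Matrix.mulVec_sub]

theorem mulModes_dotProduct (X : Tensor p) (A : Factors q p) (Y : Tensor q) :
    mulModes X A ⬝ᵥ Y = X ⬝ᵥ mulModes Y fun k => (A k)ᵀ := by
  rw [mulModes_eq_mulVec, mulModes_eq_mulVec, ← kron_transpose, Matrix.dotProduct_mulVec,
    Matrix.vecMul_transpose]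

theorem frob_sq (X : Tensor p) : frob X ^ 2 = X ⬝ᵥ X := by
  rw [frob, Real.sq_sqrt (sum_nonneg fun _ _ => sq_nonneg _), dotProduct]
  exact sum_congr rfl fun _ _ => sq _

theorem frob_nonneg (X : Tensor p) : 0 ≤ frob X := Real.sqrt_nonneg _

theorem frob_eq_norm (X : Tensor p) : frob X = ‖WithLp.toLp 2 X‖ := by
  simp [frob, EuclideanSpace.norm_eq]

/-! ### Contractions -/

/-- Summation over multi-indices as an iterated sum. -/
def tripleEquiv (p : Fin 3 → ℕ) : (∀ k, Fin (p k)) ≃ Fin (p 0) × Fin (p 1) × Fin (p 2) where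
  toFun i := (i 0, i 1, i 2)
  invFun t := fun k => match k with
    | 0 => t.1
    | 1 => t.2.1
    | 2 => t.2.2
  left_inv i := by
    funext k
    fin_cases k <;> rfl
  right_inv _ := rfl

theorem sum_triple (f : (∀ k, Fin (p k)) → ℝ) :
    ∑ i, f i = ∑ a, ∑ b, ∑ c, f ((tripleEquiv p).symm (a, b, c)) := by
  rw [← (tripleEquiv p).symm.sum_comp]
  simp only [Fintype.sum_prod_type]

/-- `A` does not increase the Euclidean norm. -/
def Contracts {m n : Type*} [Fintype m] [Fintype n] (A : Matrix m n ℝ) : Prop :=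
  ∀ x : n → ℝ, ∑ i, (∑ j, A i j * x j) ^ 2 ≤ ∑ j, x j ^ 2

/-- The three modes are contracted one at a time; before each use of the hypothesis the sums are
reordered so that the mode in question is innermost. -/
theorem frob_mulModes_sq_le (X : Tensor p) (A : Factors q p) (hA : ∀ k, Contracts (A k)) :
    frob (mulModes X A) ^ 2 ≤ frob X ^ 2 := by
  have hL : frob (mulModes X A) ^ 2 = ∑ a, ∑ b, ∑ c, (∑ a', A 0 a a' * ∑ b', A 1 b b' *
      ∑ c', A 2 c c' * X ((tripleEquiv p).symm (a', b', c'))) ^ 2 := by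
    rw [frob, Real.sq_sqrt (sum_nonneg fun _ _ => sq_nonneg _), sum_triple]
    refine sum_congr rfl fun a _ => sum_congr rfl fun b _ => sum_congr rfl fun c _ => ?_
    congr 1
    rw [mulModes, sum_triple]
    simp only [mul_sum, Fin.prod_univ_three]
    refine sum_congr rfl fun a' _ => sum_congr rfl fun b' _ => sum_congr rfl fun c' _ => ?_
    simp only [tripleEquiv, Equiv.coe_fn_symm_mk]
    ring
  have hR : frob X ^ 2 = ∑ a, ∑ b, ∑ c, X ((tripleEquiv p).symm (a, b, c)) ^ 2 := by
    rw [frob, Real.sq_sqrt (sum_nonneg fun _ _ => sq_nonneg _), sum_triple]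
  rw [hL, hR]
  set x := fun a b c => X ((tripleEquiv p).symm (a, b, c))
  calc _ = ∑ b, ∑ c, ∑ a, (∑ a', A 0 a a' * ∑ b', A 1 b b' * ∑ c', A 2 c c' * x a' b' c') ^ 2 := by
        rw [sum_comm]
        exact sum_congr rfl fun _ _ => sum_comm
    _ ≤ ∑ b, ∑ c, ∑ a, (∑ b', A 1 b b' * ∑ c', A 2 c c' * x a b' c') ^ 2 :=
        sum_le_sum fun b _ => sum_le_sum fun c _ => hA 0 _
    _ = ∑ a, ∑ c, ∑ b, (∑ b', A 1 b b' * ∑ c', A 2 c c' * x a b' c') ^ 2 := by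
        simp only [sum_comm (s := (univ : Finset (Fin (q 1))))]
        rw [sum_comm]
    _ ≤ ∑ a, ∑ c, ∑ b, (∑ c', A 2 c c' * x a b c') ^ 2 :=
        sum_le_sum fun a _ => sum_le_sum fun c _ => hA 1 _
    _ = ∑ a, ∑ b, ∑ c, (∑ c', A 2 c c' * x a b c') ^ 2 :=
        sum_congr rfl fun _ _ => sum_comm
    _ ≤ ∑ a, ∑ b, ∑ c, x a b c ^ 2 :=
        sum_le_sum fun a _ => sum_le_sum fun b _ => hA 2 _

/-! ### The basic inequality for the maximum likelihood estimator -/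

theorem frob_sub_sq (X Y : Tensor p) :
    frob (X - Y) ^ 2 = frob X ^ 2 - 2 * (X ⬝ᵥ Y) + frob Y ^ 2 := by
  simp only [frob_sq, sub_dotProduct, dotProduct_sub, dotProduct_comm Y X]
  ring

/-- The projection is symmetric and fixes every tensor of the form `mulModes T V`. -/
theorem projectTensor_dotProduct_self {r : Fin 3 → ℕ} (Y : Tensor p) {V : Factors p r}
    (hV : Orthonormals V) (T : Tensor r) :
    Y ⬝ᵥ mulModes T V = projectTensor Y V ⬝ᵥ mulModes T V := by
  rw [projectTensor, mulModes_dotProduct, mulModes_mulModes]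
  congr 2
  funext k
  rw [Matrix.transpose_mul, Matrix.transpose_transpose, Matrix.mul_assoc, hV k, Matrix.mul_one]

theorem projectTensor_eq {r : Fin 3 → ℕ} (Y : Tensor p) (V : Factors p r) :
    projectTensor Y V = mulModes (mulModes Y fun k => (V k)ᵀ) V := by
  rw [mulModes_mulModes, projectTensor]

theorem frob_projectTensor_sq {r : Fin 3 → ℕ} (Y : Tensor p) {V : Factors p r}
    (hV : Orthonormals V) :
    frob (projectTensor Y V) ^ 2 = frob (mulModes Y fun k => (V k)ᵀ) ^ 2 := by
  rw [frob_sq, frob_sq, projectTensor_eq, mulModes_dotProduct, mulModes_mulModes]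
  congr 1
  rw [mulModes_mulModes]
  congr 1
  funext k
  simp [hV k]

theorem frob_sub_projectTensor_sq {r : Fin 3 → ℕ} (Y : Tensor p) {V : Factors p r}
    (hV : Orthonormals V) :
    frob (Y - projectTensor Y V) ^ 2
      = frob Y ^ 2 - frob (mulModes Y fun k => (V k)ᵀ) ^ 2 := by
  have h : Y ⬝ᵥ projectTensor Y V = frob (projectTensor Y V) ^ 2 := by
    rw [frob_sq]
    conv_lhs => rw [projectTensor_eq, projectTensor_dotProduct_self Y hV, ← projectTensor_eq]
  rw [frob_sub_sq, h, frob_projectTensor_sq Y hV]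
  ring

/-- Pythagoras turns maximality of the compressed norm into minimality of the residual among
projections, and for fixed `U` the projection is at least as close to `Y` as any other core `S`. -/
theorem IsMLE.frob_sub_sq_le {r : Fin 3 → ℕ} {Y : Tensor p} {V U : Factors p r} (hV : IsMLE Y V)
    (hU : Orthonormals U) (S : Tensor r) :
    frob (Y - projectTensor Y V) ^ 2 ≤ frob (Y - mulModes S U) ^ 2 := by
  have h1 := frob_sub_projectTensor_sq Y hU
  have h2 := frob_sub_projectTensor_sq Y hV.1
  have h3 := hV.2 U hU
  have h4 : frob (Y - projectTensor Y U) ^ 2 ≤ frob (Y - mulModes S U) ^ 2 := by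
    have h5 := projectTensor_dotProduct_self Y hU S
    have h6 := frob_sub_sq (projectTensor Y U) (mulModes S U)
    rw [h1, frob_sub_sq Y (mulModes S U), h5]
    have h7 := sq_nonneg (frob (projectTensor Y U - mulModes S U))
    have h8 := frob_projectTensor_sq Y hU
    linarith
  linarith

/-- With D the error, minimality against the truth reads ‖Z − D‖² ≤ ‖Z‖²; expanding the square gives
the claim. -/
theorem IsMLE.frob_projectTensor_sub_sq_le {r : Fin 3 → ℕ} {Z : Tensor p} {V U : Factors p r}
    {S : Tensor r} (hV : IsMLE (mulModes S U + Z) V) (hU : Orthonormals U) :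
    frob (projectTensor (mulModes S U + Z) V - mulModes S U) ^ 2
      ≤ 2 * (Z ⬝ᵥ (projectTensor (mulModes S U + Z) V - mulModes S U)) := by
  have h := hV.frob_sub_sq_le hU S
  set X := mulModes S U
  set D := projectTensor (X + Z) V - X with hD
  have e1 : X + Z - projectTensor (X + Z) V = Z - D := by rw [hD]; abel
  have e2 : X + Z - X = Z := by abel
  rw [e1, e2, frob_sub_sq] at h
  linarith

/-! ### Nets -/

section Nets

variable {E : Type*} [NormedAddCommGroup E] [NormedSpace ℝ E] [FiniteDimensional ℝ E]

variable (E) in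
-- A 1/2-separated subset of the unit ball has at most 5^dim points by volume. If no such set were a
-- net, points could be added to it forever, exceeding that bound.
theorem exists_half_net : ∃ N : Finset E, N.card ≤ 5 ^ Module.finrank ℝ E ∧ (∀ y ∈ N, ‖y‖ ≤ 1) ∧
    ∀ x : E, ‖x‖ ≤ 1 → ∃ y ∈ N, ‖x - y‖ ≤ 1 / 2 := by
  classical
  have hcard : ∀ N : Finset E, (∀ y ∈ N, ‖y‖ ≤ 1) →
      (∀ c ∈ N, ∀ d ∈ N, c ≠ d → 1 / 2 ≤ ‖c - d‖) → N.card ≤ 5 ^ Module.finrank ℝ E := by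
    intro N hN hs
    -- The volume bound is stated for 1-separated points in the ball of radius 2, hence the dilation
    -- by 2.
    have hinj : Function.Injective fun y : E => (2 : ℝ) • y := smul_right_injective E two_ne_zero
    rw [← card_image_of_injective N hinj]
    refine Besicovitch.card_le_of_separated _ ?_ ?_
    · simp only [mem_image, forall_exists_index, and_imp, forall_apply_eq_imp_iff₂, norm_smul,
        Real.norm_ofNat]
      intro y hy
      linarith [hN y hy]
    · simp only [mem_image, forall_exists_index, and_imp, forall_apply_eq_imp_iff₂, ← smul_sub,
        norm_smul, Real.norm_ofNat]
      intro c hc d hd hcd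
      have := hs c hc d hd fun h => hcd (by rw [h])
      linarith
  by_contra! hcon
  have key : ∀ n : ℕ, ∃ N : Finset E, N.card = n ∧ (∀ y ∈ N, ‖y‖ ≤ 1) ∧
      ∀ c ∈ N, ∀ d ∈ N, c ≠ d → 1 / 2 ≤ ‖c - d‖ := by
    intro n
    induction n with
    | zero => exact ⟨∅, by simp⟩
    | succ n ih =>
      obtain ⟨N, hn, hN, hs⟩ := ih
      obtain ⟨x, hx, hxN⟩ := hcon N (hcard N hN hs) hN
      have hxm : x ∉ N := fun h => by
        have := hxN x h
        norm_num at this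
      refine ⟨insert x N, by rw [card_insert_of_notMem hxm, hn], ?_, ?_⟩
      · intro y hy
        rcases mem_insert.1 hy with rfl | hy
        exacts [hx, hN y hy]
      · intro c hc d hd hcd
        rcases mem_insert.1 hc with rfl | hc' <;> rcases mem_insert.1 hd with rfl | hd'
        · exact absurd rfl hcd
        · exact (hxN d hd').le
        · rw [norm_sub_rev]
          exact (hxN c hc').le
        · exact hs c hc' d hd' hcd
  obtain ⟨N, hn, hN, hs⟩ := key (5 ^ Module.finrank ℝ E + 1)
  have := hcard N hN hs
  omega

/-- Approximating a point of the ball by the net gives ‖f‖ ≤ B + ‖f‖/2, which is self-improving to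
‖f‖ ≤ 2B. -/
theorem abs_le_of_half_net {N : Finset E} (hN : ∀ x : E, ‖x‖ ≤ 1 → ∃ y ∈ N, ‖x - y‖ ≤ 1 / 2)
    (f : E →ₗ[ℝ] ℝ) {B : ℝ} (hB : ∀ y ∈ N, |f y| ≤ B) {x : E} (hx : ‖x‖ ≤ 1) : |f x| ≤ 2 * B := by
  set g : E →L[ℝ] ℝ := LinearMap.toContinuousLinearMap f with hg
  have hfg : ∀ y, f y = g y := fun _ => rfl
  have hle : ∀ x : E, ‖x‖ ≤ 1 → ‖g x‖ ≤ B + ‖g‖ / 2 := by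
    intro x hx
    obtain ⟨y, hy, hxy⟩ := hN x hx
    calc ‖g x‖ = ‖g y + g (x - y)‖ := by rw [← map_add, add_sub_cancel]
      _ ≤ ‖g y‖ + ‖g (x - y)‖ := norm_add_le _ _
      _ ≤ B + ‖g‖ * (1 / 2) := by
        gcongr
        · exact hB y hy
        · exact (g.le_opNorm _).trans (by gcongr)
      _ = B + ‖g‖ / 2 := by ring
  have h0 : 0 ≤ B + ‖g‖ / 2 := (norm_nonneg _).trans (hle 0 (by simp))
  have hnorm : ‖g‖ ≤ B + ‖g‖ / 2 :=
    ContinuousLinearMap.opNorm_le_of_unit_norm h0 fun x hx => hle x hx.le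
  rw [hfg]
  have := hle x hx
  rw [Real.norm_eq_abs] at this
  linarith

end Nets

/-- The arguments are released from the net to the whole ball one at a time; each release is a
linear problem and costs a factor 2. -/
theorem abs_multilinear_le_of_half_net {ι : Type*} [Fintype ι] [DecidableEq ι] {E : ι → Type*}
    [∀ i, NormedAddCommGroup (E i)] [∀ i, NormedSpace ℝ (E i)] [∀ i, FiniteDimensional ℝ (E i)]
    {N : ∀ i, Finset (E i)}
    (hN : ∀ i, ∀ x : E i, ‖x‖ ≤ 1 → ∃ y ∈ N i, ‖x - y‖ ≤ 1 / 2)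
    (f : MultilinearMap ℝ E ℝ) {B : ℝ} (hB : ∀ y : ∀ i, E i, (∀ i, y i ∈ N i) → |f y| ≤ B)
    {x : ∀ i, E i} (hx : ∀ i, ‖x i‖ ≤ 1) : |f x| ≤ 2 ^ Fintype.card ι * B := by
  have key : ∀ s : Finset ι, ∀ x : ∀ i, E i, (∀ i ∈ s, ‖x i‖ ≤ 1) → (∀ i ∉ s, x i ∈ N i) →
      |f x| ≤ 2 ^ s.card * B := by
    intro s
    induction s using Finset.induction_on with
    | empty => simpa using fun x hx => hB x hx
    | insert a s ha ih =>
      intro x h1 h2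
      have h3 : ∀ y ∈ N a, |f.toLinearMap x a y| ≤ 2 ^ s.card * B := by
        intro y hy
        refine ih _ (fun i hi => ?_) fun i hi => ?_
        · rw [Function.update_of_ne (ne_of_mem_of_not_mem hi ha)]
          exact h1 i (mem_insert_of_mem hi)
        · by_cases hia : i = a
          · subst hia
            rwa [Function.update_self]
          · rw [Function.update_of_ne hia]
            exact h2 i (by simp [hia, hi])
      have h4 := abs_le_of_half_net (hN a) (f.toLinearMap x a) h3 (h1 a (mem_insert_self _ _))
      rw [MultilinearMap.toLinearMap_apply, Function.update_eq_self] at h4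
      rw [card_insert_of_notMem ha, pow_succ]
      linarith
  simpa using key univ x (fun i _ => hx i) fun i hi => absurd (mem_univ i) hi

/-! ### Contractions in operator norm and a net for low-rank tensors -/

open scoped Matrix.Norms.L2Operator

theorem contracts_of_norm_le_one {m n : Type*} [Fintype m] [Fintype n] [DecidableEq n]
    {A : Matrix m n ℝ} (hA : ‖A‖ ≤ 1) : Contracts A := by
  intro x
  have h := (A.l2_opNorm_mulVec (WithLp.toLp 2 x)).trans
    (mul_le_of_le_one_left (norm_nonneg _) hA)
  have h2 := pow_le_pow_left₀ (norm_nonneg _) h 2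
  rw [EuclideanSpace.norm_sq_eq, EuclideanSpace.norm_sq_eq] at h2
  simpa [Matrix.mulVec, dotProduct] using h2

theorem norm_le_one_of_contracts {m n : Type*} [Fintype m] [Fintype n] [DecidableEq n]
    {A : Matrix m n ℝ} (hA : Contracts A) : ‖A‖ ≤ 1 := by
  rw [Matrix.l2_opNorm_def]
  refine ContinuousLinearMap.opNorm_le_bound _ zero_le_one fun x => ?_
  rw [one_mul]
  refine le_of_sq_le_sq ?_ (norm_nonneg _)
  rw [EuclideanSpace.norm_sq_eq, EuclideanSpace.norm_sq_eq]
  simpa [Matrix.mulVec, dotProduct] using hA x.ofLp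

theorem Contracts.transpose {m n : Type*} [Fintype m] [Fintype n] [DecidableEq m] [DecidableEq n]
    {A : Matrix m n ℝ} (hA : Contracts A) : Contracts Aᵀ := by
  refine contracts_of_norm_le_one ?_
  rw [← Matrix.conjTranspose_eq_transpose_of_trivial, Matrix.l2_opNorm_conjTranspose]
  exact norm_le_one_of_contracts hA

/-- The pairing of `mulModes G W` with `Z`, as a multilinear function of `W`. -/
noncomputable def pairingMultilinear {p m : Fin 3 → ℕ} (Z : Tensor p) (G : Tensor m) :
    MultilinearMap ℝ (fun k => Matrix (Fin (p k)) (Fin (m k)) ℝ) ℝ :=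
  ∑ i, ∑ j, (Z i * G j) • (MultilinearMap.mkPiAlgebra ℝ (Fin 3) ℝ).compLinearMap fun k =>
    Matrix.entryLinearMap ℝ ℝ (i k) (j k)

theorem pairingMultilinear_apply {p m : Fin 3 → ℕ} (Z : Tensor p) (G : Tensor m)
    (W : Factors p m) : pairingMultilinear Z G W = Z ⬝ᵥ mulModes G W := by
  simp only [pairingMultilinear, _root_.sum_apply, _root_.smul_apply,
    MultilinearMap.compLinearMap_apply, MultilinearMap.mkPiAlgebra_apply, dotProduct, mulModes,
    mul_sum, Matrix.entryLinearMap_apply, smul_eq_mul, mul_assoc]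

/-- A finite set of tensors of norm at most one which controls linear functionals on all tensors
of bounded multilinear rank. -/
theorem exists_tensor_net (p m : Fin 3 → ℕ) : ∃ N : Finset (Tensor p), N.Nonempty ∧
    (∀ T ∈ N, frob T ≤ 1) ∧ N.card ≤ 5 ^ (∏ k, m k + ∑ k, p k * m k) ∧
    ∀ (Z : Tensor p) (B : ℝ), (∀ T ∈ N, |Z ⬝ᵥ T| ≤ B) → ∀ (G : Tensor m) (W : Factors p m),
      frob G ≤ 1 → (∀ k, Contracts (W k)) → |Z ⬝ᵥ mulModes G W| ≤ 16 * B := by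
  classical
  obtain ⟨N₀, hc₀, h1₀, hn₀⟩ := exists_half_net (EuclideanSpace ℝ (∀ k, Fin (m k)))
  -- The factor nets are taken in operator norm, so their elements are contractions and the
  -- resulting tensors keep norm at most one.
  choose N₁ hc₁ h1₁ hn₁ using fun k => exists_half_net (Matrix (Fin (p k)) (Fin (m k)) ℝ)
  set N : Finset (Tensor p) :=
    (N₀ ×ˢ Fintype.piFinset N₁).image fun t => mulModes t.1.ofLp t.2 with hNdef
  have hmem : ∀ y ∈ N₀, ∀ z : Factors p m, (∀ k, z k ∈ N₁ k) → mulModes y.ofLp z ∈ N :=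
    fun y hy z hz =>
      mem_image.2 ⟨(y, z), mem_product.2 ⟨hy, Fintype.mem_piFinset.2 hz⟩, rfl⟩
  refine ⟨N, ?_, ?_, ?_, ?_⟩
  · obtain ⟨y, hy, -⟩ := hn₀ 0 (by simp)
    choose z hz _ using fun k => hn₁ k 0 (by simp)
    exact ⟨_, hmem y hy z hz⟩
  · simp only [hNdef, mem_image, mem_product, Fintype.mem_piFinset, Prod.exists, forall_exists_index,
      and_imp]
    rintro T y z hy hz rfl
    have h := frob_mulModes_sq_le y.ofLp z fun k => contracts_of_norm_le_one (h1₁ k _ (hz k))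
    have hy1 : frob y.ofLp ≤ 1 := by
      rw [frob_eq_norm]
      exact h1₀ y hy
    exact (le_of_sq_le_sq h (frob_nonneg _)).trans hy1
  · refine card_image_le.trans ?_
    rw [card_product, Fintype.card_piFinset, pow_add]
    refine Nat.mul_le_mul (hc₀.trans_eq ?_) ?_
    · simp
    · rw [← prod_pow_eq_pow_sum]
      refine prod_le_prod' fun k _ => (hc₁ k).trans_eq ?_
      simp [Module.finrank_matrix]
  · intro Z B hB G W hG hW
    -- The three factors cost 2³ = 8; releasing the core afterwards costs one more 2, whence 16.
    have h2 : ∀ y ∈ N₀, |Z ⬝ᵥ mulModes y.ofLp W| ≤ 8 * B := by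
      intro y hy
      have := abs_multilinear_le_of_half_net hn₁ (pairingMultilinear Z y.ofLp)
        (B := B) (fun z hz => by
          rw [pairingMultilinear_apply]
          exact hB _ (hmem y hy z hz)) (x := W) fun k => norm_le_one_of_contracts (hW k)
      rw [pairingMultilinear_apply] at this
      norm_num at this
      exact this
    let f : EuclideanSpace ℝ (∀ k, Fin (m k)) →ₗ[ℝ] ℝ :=
      dotProductBilin ℝ ℝ Z ∘ₗ (kron W).mulVecLin ∘ₗ (WithLp.linearEquiv 2 ℝ _).toLinearMap
    have hf : ∀ y, f y = Z ⬝ᵥ mulModes y.ofLp W := fun y => by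
      rw [mulModes_eq_mulVec]
      rfl
    have := abs_le_of_half_net hn₀ f (B := 8 * B) (fun y hy => by rw [hf]; exact h2 y hy)
      (x := WithLp.toLp 2 G) (by rwa [← frob_eq_norm])
    rw [hf] at this
    linarith

/-- Any `m` vectors lie in the range of a contraction with `m` columns which acts as the identity
on them when composed with its transpose. -/
theorem exists_contracts_mul_transpose_mulVec {n : ℕ} {ι : Type*} [Fintype ι] {m : ℕ}
    (hm : Fintype.card ι ≤ m) (v : ι → EuclideanSpace ℝ (Fin n)) :
    ∃ W : Matrix (Fin n) (Fin m) ℝ, Contracts W ∧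
      ∀ i, (W * Wᵀ) *ᵥ (v i).ofLp = (v i).ofLp := by
  set K := Submodule.span ℝ (Set.range v)
  have hd : Module.finrank ℝ K ≤ m := (finrank_range_le_card v).trans hm
  let b := stdOrthonormalBasis ℝ K
  have hb : Orthonormal ℝ fun j => (b j : EuclideanSpace ℝ (Fin n)) :=
    b.orthonormal.comp_linearIsometry K.subtypeₗᵢ
  let e : Fin (Module.finrank ℝ K) → Fin m := Fin.castLE hd
  have he : Function.Injective e := Fin.castLE_injective hd
  -- An orthonormal basis of the span, padded with zero columns up to `m`.
  let w : Fin m → EuclideanSpace ℝ (Fin n) := Function.extend e (fun j => (b j : _)) 0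
  have hw : ∀ j, w (e j) = b j := fun j => he.extend_apply _ _ _
  have hw0 : ∀ j, j ∉ Set.range e → w j = 0 := fun j hj =>
    Function.extend_apply' _ _ _ fun ⟨a, ha⟩ => hj ⟨a, ha⟩
  have hin : ∀ j (x : EuclideanSpace ℝ (Fin n)), ∑ i, w j i * x i = inner ℝ (w j) x := by
    intro j x
    rw [PiLp.inner_apply]
    simp [mul_comm]
  have hT : Contracts (Matrix.of fun j i => w j i) := by
    intro x
    have h1 : ∑ j, (∑ i, w j i * x i) ^ 2 = ∑ j, inner ℝ (b j : EuclideanSpace ℝ (Fin n))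
        (WithLp.toLp 2 x) ^ 2 := by
      symm
      refine Fintype.sum_of_injective e he _ _ (fun j hj => by simp [hw0 j hj]) fun j => ?_
      rw [← hw, ← hin]
    have h2 := hb.sum_inner_products_le (WithLp.toLp 2 x) (s := univ)
    simp only [Real.norm_eq_abs, sq_abs, EuclideanSpace.norm_sq_eq] at h2
    simpa only [Matrix.of_apply, h1] using h2
  refine ⟨Matrix.of fun i j => w j i, hT.transpose, fun l => ?_⟩
  have hl : v l ∈ K := Submodule.subset_span ⟨l, rfl⟩
  have hsum := congrArg (fun x : K => (x : EuclideanSpace ℝ (Fin n))) (b.sum_repr' ⟨v l, hl⟩)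
  ext i
  rw [← Matrix.mulVec_mulVec]
  have h3 : ∀ j, ((Matrix.of fun i j => w j i)ᵀ *ᵥ (v l).ofLp) j = inner ℝ (w j) (v l) :=
    fun j => hin j (v l)
  rw [Matrix.mulVec, dotProduct]
  simp only [h3, Matrix.of_apply]
  have h4 : ∑ j, w j i * inner ℝ (w j) (v l)
      = ∑ j, (b j : EuclideanSpace ℝ (Fin n)) i * inner ℝ (b j : EuclideanSpace ℝ (Fin n)) (v l) := by
    symm
    refine Fintype.sum_of_injective e he _ _ (fun j hj => by simp [hw0 j hj]) fun j => ?_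
    rw [← hw]
  rw [h4]
  have h5 := congrArg (fun x : EuclideanSpace ℝ (Fin n) => x i) hsum
  simp only [Submodule.coe_sum, Submodule.coe_smul, Submodule.coe_inner] at h5
  rw [← h5, WithLp.ofLp_sum, Finset.sum_apply]
  exact sum_congr rfl fun j _ => by simp [mul_comm]

/-! ### Gaussian maxima -/

section Gaussian

open scoped NNReal

/-- The weight consumes at most half of the Gaussian exponent, since v ≤ σ²; the remaining rate `b`
is at least 1/(4v), so a Gaussian integral is left. -/
theorem integrable_exp_sq_gaussianReal {v : ℝ≥0} {σ : ℝ} (hσ : 0 < σ) (hv : (v : ℝ) ≤ σ ^ 2) :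
    Integrable (fun x => Real.exp (x ^ 2 / (4 * σ ^ 2))) (gaussianReal 0 v) ∧
      ∫ x, Real.exp (x ^ 2 / (4 * σ ^ 2)) ∂gaussianReal 0 v ≤ 2 := by
  rcases eq_or_ne v 0 with rfl | hv0
  · rw [gaussianReal_zero_var]
    refine ⟨integrable_dirac (by simp), ?_⟩
    rw [integral_dirac]
    simp
  have hvpos : (0 : ℝ) < v := by positivity
  set b : ℝ := 1 / (2 * v) - 1 / (4 * σ ^ 2) with hbdef
  have hb : 1 / (4 * (v : ℝ)) ≤ b := by
    have h1 : 1 / (4 * σ ^ 2) ≤ 1 / (4 * (v : ℝ)) := by gcongr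
    have h2 : 1 / (2 * (v : ℝ)) = 1 / (4 * v) + 1 / (4 * v) := by field_simp; norm_num
    rw [hbdef, h2]
    linarith
  have hb0 : 0 < b := lt_of_lt_of_le (by positivity) hb
  have hprod : ∀ x : ℝ, gaussianPDFReal 0 v x • Real.exp (x ^ 2 / (4 * σ ^ 2))
      = (√(2 * Real.pi * v))⁻¹ * Real.exp (-b * x ^ 2) := by
    intro x
    rw [gaussianPDFReal_def, smul_eq_mul, mul_assoc, ← Real.exp_add]
    congr 2
    rw [hbdef]
    field_simp
    ring
  constructor
  · rw [gaussianReal_of_var_ne_zero _ hv0,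
      integrable_withDensity_iff_integrable_smul₀' (measurable_gaussianPDF _ _).aemeasurable
        (ae_of_all _ fun _ => gaussianPDF_lt_top)]
    simp only [toReal_gaussianPDF, hprod]
    exact (integrable_exp_neg_mul_sq hb0).const_mul _
  · rw [integral_gaussianReal_eq_integral_smul hv0]
    simp only [hprod]
    rw [integral_const_mul, integral_gaussian, inv_mul_le_iff₀ (by positivity)]
    rw [show (√(2 * Real.pi * v)) * 2 = √(2 * Real.pi * v * 4) by
      rw [Real.sqrt_mul (by positivity) 4, show (4 : ℝ) = 2 ^ 2 by norm_num,
        Real.sqrt_sq (by norm_num)]]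
    refine Real.sqrt_le_sqrt ?_
    rw [div_le_iff₀ hb0]
    calc Real.pi ≤ Real.pi * 2 := by linarith [Real.pi_pos]
      _ = 2 * Real.pi * v * 4 * (1 / (4 * v)) := by field_simp
      _ ≤ _ := by gcongr

variable {Ω : Type*} [MeasurableSpace Ω] {P : Measure Ω}

theorem hasLaw_sum_gaussian {ι : Type*} [Fintype ι] {Z : ι → Ω → ℝ} {v : ℝ≥0}
    (hind : iIndepFun Z P) (hlaw : ∀ i, HasLaw (Z i) (gaussianReal 0 v) P) (T : ι → ℝ) :
    ∃ w : ℝ≥0, (w : ℝ) = v * ∑ i, T i ^ 2 ∧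
      HasLaw (fun ω => ∑ i, Z i ω * T i) (gaussianReal 0 w) P := by
  refine ⟨v * ∑ i, ‖T i‖₊ ^ 2, by simp, ?_⟩
  have hZ : ∀ i, HasGaussianLaw (Z i) P := fun i => ⟨by rw [(hlaw i).map_eq]; infer_instance⟩
  have hX : ∀ i, HasGaussianLaw (fun ω => Z i ω * T i) P := fun i => by
    simpa [mul_comm] using (hZ i).fun_smul (T i)
  have hXi : iIndepFun (fun i ω => Z i ω * T i) P :=
    hind.comp (fun i x => x * T i) fun i => measurable_id.mul_const _
  have hsum := iIndepFun.hasGaussianLaw_fun_sum hX hXi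
  refine ⟨hsum.aemeasurable, ?_⟩
  rw [hsum.map_eq_gaussianReal]
  have hmean : ∀ i, ∫ ω, Z i ω * T i ∂P = 0 := fun i => by
    rw [integral_mul_const, (hlaw i).integral_eq]
    simp
  have hvar : ∀ i, Var[fun ω => Z i ω * T i; P] = v * T i ^ 2 := fun i => by
    rw [variance_mul_const, (hlaw i).variance_eq]
    simp
  congr 1
  · rw [integral_finsetSum _ fun i _ => (hX i).integrable]
    simp [hmean]
  · have h := IndepFun.variance_sum (μ := P) (s := univ) (X := fun i ω => Z i ω * T i)
      (fun i _ => (hX i).memLp_two) fun i _ j _ hij => hXi.indepFun hij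
    have h2 : (fun ω => ∑ i, Z i ω * T i) = ∑ i, fun ω => Z i ω * T i := by
      ext ω
      simp
    rw [h2, h]
    simp only [hvar, ← mul_sum]
    ext
    rw [Real.coe_toNNReal _ (by positivity)]
    simp

/-- The second moment of the maximum of finitely many centred Gaussian variables. -/
theorem exists_integrable_sq_bound [IsProbabilityMeasure P] {ι : Type*} [Fintype ι] {Z : ι → Ω → ℝ} {σ : ℝ} (hσ : 0 < σ)
    (hind : iIndepFun Z P)
    (hlaw : ∀ i, HasLaw (Z i) (gaussianReal 0 (Real.toNNReal (σ ^ 2))) P)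
    {N : Finset (ι → ℝ)} (hN : N.Nonempty) (hN1 : ∀ T ∈ N, ∑ i, T i ^ 2 ≤ 1) :
    ∃ Φ : Ω → ℝ, Integrable Φ P ∧ ∫ ω, Φ ω ∂P ≤ 4 * σ ^ 2 * (Real.log N.card + 2) ∧
      ∀ ω, ∀ T ∈ N, (∑ i, Z i ω * T i) ^ 2 ≤ Φ ω := by
  have hK : (0 : ℝ) < N.card := by exact_mod_cast hN.card_pos
  let e : (ι → ℝ) → Ω → ℝ := fun T ω => Real.exp ((∑ i, Z i ω * T i) ^ 2 / (4 * σ ^ 2))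
  have he : ∀ T ∈ N, Integrable (e T) P ∧ ∫ ω, e T ω ∂P ≤ 2 := by
    intro T hT
    obtain ⟨w, hw, hl⟩ := hasLaw_sum_gaussian hind hlaw T
    have hwσ : (w : ℝ) ≤ σ ^ 2 := by
      rw [hw, Real.coe_toNNReal _ (sq_nonneg σ)]
      exact mul_le_of_le_one_right (sq_nonneg σ) (hN1 T hT)
    obtain ⟨h1, h2⟩ := integrable_exp_sq_gaussianReal hσ hwσ
    rw [← hl.map_eq] at h1 h2
    refine ⟨h1.comp_aemeasurable hl.aemeasurable, ?_⟩
    rwa [integral_map hl.aemeasurable h1.aestronglyMeasurable] at h2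
  have hint : Integrable (fun ω => ∑ T ∈ N, e T ω) P :=
    integrable_finsetSum _ fun T hT => (he T hT).1
  have hle : ∫ ω, ∑ T ∈ N, e T ω ∂P ≤ N.card * 2 := by
    rw [integral_finsetSum _ fun T hT => (he T hT).1, ← nsmul_eq_mul]
    exact sum_le_card_nsmul _ _ _ fun T hT => (he T hT).2
  -- From u − log K + 1 ≤ exp(u)/K with u = ⟨Z, T⟩²/(4σ²) and K the cardinality, after enlarging the
  -- exponential to the sum over the net.
  refine ⟨fun ω => 4 * σ ^ 2 * (Real.log N.card + (N.card : ℝ)⁻¹ * ∑ T ∈ N, e T ω), ?_, ?_, ?_⟩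
  · exact ((integrable_const _).add (hint.const_mul _)).const_mul _
  · rw [integral_const_mul, integral_add (integrable_const _) (hint.const_mul _),
      integral_const_mul]
    simp only [integral_const, probReal_univ, one_smul]
    gcongr
    rwa [inv_mul_le_iff₀ hK]
  · intro ω T hT
    have h1 : e T ω ≤ ∑ T ∈ N, e T ω :=
      single_le_sum (f := fun T => e T ω) (fun T _ => (Real.exp_pos _).le) hT
    have h2 : (∑ i, Z i ω * T i) ^ 2 / (4 * σ ^ 2) ≤
        Real.log N.card + (N.card : ℝ)⁻¹ * ∑ T ∈ N, e T ω := by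
      have h3 := Real.add_one_le_exp ((∑ i, Z i ω * T i) ^ 2 / (4 * σ ^ 2) - Real.log N.card)
      rw [Real.exp_sub, Real.exp_log hK, div_eq_inv_mul (Real.exp _) (N.card : ℝ)] at h3
      have h4 := mul_le_mul_of_nonneg_left h1 (inv_nonneg.2 hK.le)
      simp only [e] at h4 ⊢
      linarith
    rw [div_le_iff₀ (by positivity)] at h2
    linarith

end Gaussian

/-! ### The second moment of the reconstruction error -/

/-- The normalized tensor D/‖D‖ has the form `mulModes G W` with ‖G‖ ≤ 1, so ‖D‖² ≤ 2B‖D‖. The case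
D = 0 is separate. -/
theorem frob_le_of_frob_sq_le_dotProduct {p m : Fin 3 → ℕ} {Z D : Tensor p} {B : ℝ}
    (hD : frob D ^ 2 ≤ 2 * (Z ⬝ᵥ D)) {W : Factors p m} (hW : ∀ k, Contracts (W k))
    (hWD : mulModes D (fun k => W k * (W k)ᵀ) = D)
    (hB : ∀ G : Tensor m, frob G ≤ 1 → |Z ⬝ᵥ mulModes G W| ≤ B) : frob D ≤ 2 * B := by
  rcases (frob_nonneg D).eq_or_lt with h0 | h0
  · rw [← h0]
    have := (abs_nonneg _).trans (hB 0 (by simp [frob]))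
    linarith
  set G : Tensor m := mulModes D fun k => (W k)ᵀ with hG
  have hGD : mulModes G W = D := by
    rw [hG, mulModes_mulModes, hWD]
  have hGle : frob G ≤ frob D :=
    le_of_sq_le_sq (frob_mulModes_sq_le D _ fun k => (hW k).transpose) (frob_nonneg D)
  have h1 := hB ((frob D)⁻¹ • G) (by
    rw [frob_eq_norm, WithLp.toLp_smul, norm_smul, ← frob_eq_norm, norm_inv, Real.norm_eq_abs,
      abs_of_pos h0, inv_mul_le_iff₀ h0, mul_one]
    exact hGle)
  have h2 : mulModes ((frob D)⁻¹ • G) W = (frob D)⁻¹ • D := by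
    rw [← hGD, mulModes_eq_mulVec, mulModes_eq_mulVec, Matrix.mulVec_smul, ← mulModes_eq_mulVec,
      hGD]
  rw [h2, dotProduct_smul, smul_eq_mul] at h1
  have h3 := (le_abs_self _).trans h1
  rw [inv_mul_le_iff₀ h0] at h3
  nlinarith

/-- A contraction rather than an orthonormal frame, because 2r may exceed p. -/
theorem exists_frame {p r : ℕ} (V U : Matrix (Fin p) (Fin r) ℝ) :
    ∃ W : Matrix (Fin p) (Fin (2 * r)) ℝ, Contracts W ∧ W * Wᵀ * V = V ∧ W * Wᵀ * U = U := by
  obtain ⟨W, hW, h⟩ := exists_contracts_mul_transpose_mulVec (ι := Fin r ⊕ Fin r) (m := 2 * r)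
    (by simp [two_mul]) (Sum.elim (fun j => WithLp.toLp 2 (V.col j)) fun j =>
      WithLp.toLp 2 (U.col j))
  refine ⟨W, hW, ?_, ?_⟩
  · ext i j
    exact congrFun (h (Sum.inl j)) i
  · ext i j
    exact congrFun (h (Sum.inr j)) i

theorem IsMLE.frob_projectTensor_sub_le {p r : Fin 3 → ℕ} {Z : Tensor p} {V U : Factors p r}
    {S : Tensor r} (hV : IsMLE (mulModes S U + Z) V) (hU : Orthonormals U) {B : ℝ}
    (hB : ∀ (G : Tensor fun k => 2 * r k) (W : Factors p fun k => 2 * r k), frob G ≤ 1 →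
      (∀ k, Contracts (W k)) → |Z ⬝ᵥ mulModes G W| ≤ B) :
    frob (projectTensor (mulModes S U + Z) V - mulModes S U) ≤ 2 * B := by
  choose W hW hWV hWU using fun k => exists_frame (V k) (U k)
  refine frob_le_of_frob_sq_le_dotProduct (hV.frob_projectTensor_sub_sq_le hU) hW ?_
    fun G hG => hB G W hG hW
  rw [mulModes_sub, projectTensor_eq, mulModes_mulModes _ V, mulModes_mulModes _ U]
  simp only [hWV, hWU]

/-! ### Singular values -/

theorem exists_rightSingularBasis {m n : Type*} [Fintype m] [Fintype n] [DecidableEq n]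
    (A : Matrix m n ℝ) :
    ∃ b : OrthonormalBasis (Fin (Fintype.card n)) ℝ (EuclideanSpace ℝ n),
      ∀ i, (Aᵀ * A) *ᵥ (b i).ofLp = singVal A i ^ 2 • (b i).ofLp := by
  classical
  have hn : Module.finrank ℝ (EuclideanSpace ℝ n) = Fintype.card n := finrank_euclideanSpace
  set T := Matrix.toEuclideanLin A with hT
  have key : ∀ (x : EuclideanSpace ℝ n) (c : ℝ), (T.adjoint ∘ₗ T) x = c • x →
      (Aᵀ * A) *ᵥ x.ofLp = c • x.ofLp := by
    intro x c h
    rw [hT, ← Matrix.toEuclideanLin_conjTranspose_eq_adjoint,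
      Matrix.conjTranspose_eq_transpose_of_trivial] at h
    rw [← Matrix.mulVec_mulVec]
    exact congrArg WithLp.ofLp h
  refine ⟨T.isSymmetric_adjoint_comp_self.eigenvectorBasis hn, fun i => key _ _ ?_⟩
  rw [T.isSymmetric_adjoint_comp_self.apply_eigenvectorBasis hn i, ← T.sq_singularValues_fin hn i]
  rfl

theorem singVal_nonneg {m n : Type*} [Fintype m] [Fintype n] [DecidableEq n] (A : Matrix m n ℝ)
    (i : ℕ) : 0 ≤ singVal A i := LinearMap.singularValues_nonneg _ i

theorem euclidean_inner_eq {n : Type*} [Fintype n] (x y : EuclideanSpace ℝ n) :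
    inner ℝ x y = x.ofLp ⬝ᵥ y.ofLp := by
  rw [EuclideanSpace.inner_eq_star_dotProduct, star_trivial, dotProduct_comm]

theorem orthonormalBasis_dotProduct {ι n : Type*} [Fintype ι] [DecidableEq ι] [Fintype n]
    (b : OrthonormalBasis ι ℝ (EuclideanSpace ℝ n)) (i j : ι) :
    (b i).ofLp ⬝ᵥ (b j).ofLp = if i = j then 1 else 0 := by
  rw [← euclidean_inner_eq, orthonormal_iff_ite.1 b.orthonormal]

theorem trace_eq_sum_orthonormalBasis {ι n : Type*} [Fintype ι] [Fintype n] [DecidableEq n]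
    (b : OrthonormalBasis ι ℝ (EuclideanSpace ℝ n)) (M : Matrix n n ℝ) :
    M.trace = ∑ i, (b i).ofLp ⬝ᵥ (M *ᵥ (b i).ofLp) := by
  have h1 := LinearMap.trace_eq_sum_inner (Matrix.toEuclideanLin M) b
  have h2 := LinearMap.trace_eq_sum_inner (Matrix.toEuclideanLin M) (EuclideanSpace.basisFun n ℝ)
  rw [h1] at h2
  simp only [euclidean_inner_eq] at h2
  refine Eq.trans ?_ h2.symm
  rw [Matrix.trace]
  refine sum_congr rfl fun i _ => ?_
  simp [Matrix.toLpLin_apply]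

/-- The right-hand side is polynomial in the entries, which is what later makes functions of the
singular values measurable. -/
theorem sum_singVal_pow_eq_trace {m : Type*} [Fintype m] {r : ℕ} (A : Matrix m (Fin r) ℝ) (n : ℕ) :
    ∑ i : Fin r, (singVal A i ^ 2) ^ n = ((Aᵀ * A) ^ n).trace := by
  obtain ⟨b, hb⟩ := exists_rightSingularBasis A
  have h : ∀ (n : ℕ) i, (Aᵀ * A) ^ n *ᵥ (b i).ofLp = (singVal A i ^ 2) ^ n • (b i).ofLp := by
    intro n i
    induction n with
    | zero => simp
    | succ n ih =>
      rw [pow_succ, ← Matrix.mulVec_mulVec, hb, Matrix.mulVec_smul, ih, smul_smul, ← pow_succ']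
  rw [trace_eq_sum_orthonormalBasis b]
  simp only [h, dotProduct_smul, orthonormalBasis_dotProduct, if_true, smul_eq_mul, mul_one]
  exact (Equiv.sum_comp (finCongr (Fintype.card_fin r))
    fun i : Fin r => (singVal A i ^ 2) ^ n).symm

theorem sum_mulVec_sq {m n : Type*} [Fintype m] [Fintype n] (A : Matrix m n ℝ) (x : n → ℝ) :
    ∑ i, (∑ j, A i j * x j) ^ 2 = x ⬝ᵥ ((Aᵀ * A) *ᵥ x) := by
  rw [← Matrix.mulVec_mulVec, Matrix.dotProduct_mulVec, Matrix.vecMul_transpose]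
  simp [dotProduct, Matrix.mulVec, sq]

theorem Contracts.singVal_le_one {m : Type*} [Fintype m] {r : ℕ} {A : Matrix m (Fin r) ℝ}
    (hA : Contracts A) (i : Fin r) : singVal A i ≤ 1 := by
  obtain ⟨b, hb⟩ := exists_rightSingularBasis A
  let j : Fin (Fintype.card (Fin r)) := finCongr (Fintype.card_fin r).symm i
  have h := hA (b j).ofLp
  rw [sum_mulVec_sq, hb, dotProduct_smul, orthonormalBasis_dotProduct, if_pos rfl] at h
  have h1 : ∑ k, (b j).ofLp k ^ 2 = 1 := by
    have := orthonormalBasis_dotProduct b j j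
    rw [if_pos rfl, dotProduct] at this
    simpa only [sq] using this
  rw [h1, smul_eq_mul, mul_one] at h
  have : (j : ℕ) = i := rfl
  rw [this] at h
  nlinarith [singVal_nonneg A i]

theorem sum_sq_eq_trace {m n : Type*} [Fintype m] [Fintype n] (A : Matrix m n ℝ) :
    ∑ i, ∑ j, A i j ^ 2 = (Aᵀ * A).trace := by
  rw [sum_comm]
  simp [Matrix.trace, Matrix.mul_apply, sq]

/-- Multiplication on the right by `H` expands the Frobenius norm by at least the smallest of the
first `r` singular values of `U * H`, when `U` is orthonormal with `r` columns. -/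
theorem singVal_sq_mul_sum_sq_le {m n : Type*} {r : ℕ} [Fintype m] [Fintype n] [DecidableEq n]
    {U : Matrix m (Fin r) ℝ} (hU : Uᵀ * U = 1) (H : Matrix (Fin r) n ℝ)
    (hs : 0 < singVal (U * H) (r - 1)) {a : Type*} [Fintype a] (N : Matrix a (Fin r) ℝ) :
    singVal (U * H) (r - 1) ^ 2 * ∑ i, ∑ j, N i j ^ 2 ≤ ∑ i, ∑ c, (N * H) i c ^ 2 := by
  obtain ⟨b, hb⟩ := exists_rightSingularBasis (U * H)
  have hUH : (U * H)ᵀ * (U * H) = Hᵀ * H := by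
    rw [Matrix.transpose_mul, Matrix.mul_assoc, ← Matrix.mul_assoc Uᵀ, hU, Matrix.one_mul]
  rw [hUH] at hb
  have hr : r ≤ Fintype.card n := by
    by_contra! hlt
    have : singVal (U * H) (r - 1) = 0 := by
      refine LinearMap.singularValues_of_finrank_le _ ?_
      rw [finrank_euclideanSpace]
      omega
    linarith
  set s : Fin r → ℝ := fun i => singVal (U * H) i with hsdef
  have hsi : ∀ i, singVal (U * H) (r - 1) ≤ s i := fun i =>
    LinearMap.singularValues_antitone _ (by omega)
  have hpos : ∀ i, 0 < s i := fun i => hs.trans_le (hsi i)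
  let v : Fin r → n → ℝ := fun i => (b (Fin.castLE hr i)).ofLp
  have hv : ∀ i, (Hᵀ * H) *ᵥ v i = s i ^ 2 • v i := fun i => hb _
  have hvv : ∀ i j, v i ⬝ᵥ v j = if i = j then 1 else 0 := fun i j => by
    simp only [v, orthonormalBasis_dotProduct, (Fin.castLE_injective hr).eq_iff]
  -- The left singular vectors of `H`: being r orthonormal vectors in dimension r, they form a
  -- basis. Expanding a row y of `N` in it, y·H has coefficient s_k⟨w_k, y⟩ along v_k, and Bessel
  -- finishes.
  let w : Fin r → EuclideanSpace ℝ (Fin r) := fun i => WithLp.toLp 2 ((s i)⁻¹ • (H *ᵥ v i))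
  have hHH : ∀ i j, (H *ᵥ v i) ⬝ᵥ (H *ᵥ v j) = if i = j then s i ^ 2 else 0 := fun i j => by
    rw [Matrix.dotProduct_mulVec, ← Matrix.mulVec_transpose, Matrix.mulVec_mulVec, hv,
      smul_dotProduct, hvv]
    simp
  have hw : Orthonormal ℝ w := by
    rw [orthonormal_iff_ite]
    intro i j
    rw [euclidean_inner_eq]
    simp only [w, smul_dotProduct, dotProduct_smul, hHH, smul_eq_mul]
    split_ifs with h
    · subst h
      have := (hpos i).ne'
      field_simp
    · simp
  have hspan : ⊤ ≤ Submodule.span ℝ (Set.range w) :=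
    (hw.linearIndependent.span_eq_top_of_card_eq_finrank' (by simp)).ge
  let B := OrthonormalBasis.mk hw hspan
  have hBw : ∀ i, B i = w i := fun i => by simp [B]
  rw [mul_sum]
  refine sum_le_sum fun i _ => ?_
  set y : Fin r → ℝ := N i with hy
  have h1 : ∑ j, y j ^ 2 = ∑ j, ((w j).ofLp ⬝ᵥ y) ^ 2 := by
    have := B.sum_sq_norm_inner_right (WithLp.toLp 2 y)
    rw [EuclideanSpace.norm_sq_eq] at this
    simp only [Real.norm_eq_abs, sq_abs, hBw, euclidean_inner_eq] at this
    exact this.symm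
  have h2 : ∑ k, (v k ⬝ᵥ (y ᵥ* H)) ^ 2 ≤ ∑ c, (N * H) i c ^ 2 := by
    have hvo : Orthonormal ℝ fun k : Fin r => b (Fin.castLE hr k) :=
      b.orthonormal.comp _ (Fin.castLE_injective hr)
    have := hvo.sum_inner_products_le (WithLp.toLp 2 (y ᵥ* H)) (s := univ)
    rw [EuclideanSpace.norm_sq_eq] at this
    simp only [Real.norm_eq_abs, sq_abs, euclidean_inner_eq] at this
    exact this
  refine le_trans ?_ h2
  rw [h1, mul_sum]
  refine sum_le_sum fun k _ => ?_
  have h3 : v k ⬝ᵥ (y ᵥ* H) = s k * ((w k).ofLp ⬝ᵥ y) := by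
    simp only [w, smul_dotProduct, smul_eq_mul]
    rw [mul_inv_cancel_left₀ (hpos k).ne', dotProduct_comm, ← Matrix.dotProduct_mulVec,
      dotProduct_comm]
  rw [h3, mul_pow]
  gcongr
  exact hsi k

/-! ### Matricization -/

/-- This exhibits the matricization of the signal as U_k times a matrix with r_k rows, the form that
`singVal_sq_mul_sum_sq_le` needs. -/
theorem matricize_mulModes (k : Fin 3) (X : Tensor p) (A : Factors q p) :
    matricize k (mulModes X A) = A k * (matricize k X *
      (Matrix.of fun (c : ∀ j : {j // j ≠ k}, Fin (q j)) (c' : ∀ j : {j // j ≠ k}, Fin (p j)) =>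
        ∏ j : {j // j ≠ k}, A j (c j) (c' j))ᵀ) := by
  ext i c
  simp only [matricize, mulModes, Matrix.of_apply, Matrix.mul_apply, Matrix.transpose_apply]
  rw [← (Equiv.piSplitAt k fun j => Fin (p j)).symm.sum_comp, Fintype.sum_prod_type]
  refine sum_congr rfl fun a _ => ?_
  rw [mul_sum]
  refine sum_congr rfl fun c' _ => ?_
  have hprod : ∏ j, A j ((Equiv.piSplitAt k fun j => Fin (q j)).symm (i, c) j)
      ((Equiv.piSplitAt k fun j => Fin (p j)).symm (a, c') j)
      = A k i a * ∏ j : {j // j ≠ k}, A j (c j) (c' j) := by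
    rw [Fintype.prod_eq_mul_prod_compl k,
      Finset.prod_subtype ({k}ᶜ : Finset (Fin 3)) (p := fun j => j ≠ k) (by simp)]
    congr 1
    · simp [Equiv.piSplitAt]
    · refine Fintype.prod_congr _ _ fun j => ?_
      have hj := j.2
      simp [Equiv.piSplitAt, hj]
  rw [hprod]
  ring

theorem matricize_sub (k : Fin 3) (X Y : Tensor p) :
    matricize k (X - Y) = matricize k X - matricize k Y := rfl

theorem sum_matricize_sq (k : Fin 3) (X : Tensor p) :
    ∑ i, ∑ c, matricize k X i c ^ 2 = frob X ^ 2 := by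
  rw [frob, Real.sq_sqrt (sum_nonneg fun _ _ => sq_nonneg _),
    ← (Equiv.piSplitAt k fun j => Fin (p j)).symm.sum_comp, Fintype.sum_prod_type]
  rfl

theorem Contracts.sum_mul_sq_le {l m n : Type*} [Fintype l] [Fintype m] [Fintype n]
    {A : Matrix m n ℝ} (hA : Contracts A) (B : Matrix n l ℝ) :
    ∑ i, ∑ c, (A * B) i c ^ 2 ≤ ∑ j, ∑ c, B j c ^ 2 := by
  rw [sum_comm, sum_comm (s := (univ : Finset n))]
  refine sum_le_sum fun c _ => ?_
  simpa only [Matrix.mul_apply] using hA fun j => B j c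

theorem Contracts.mul {l m n : Type*} [Fintype l] [Fintype m] [Fintype n]
    {A : Matrix m n ℝ} {B : Matrix n l ℝ} (hA : Contracts A) (hB : Contracts B) :
    Contracts (A * B) := by
  intro x
  have h : ∀ i, ∑ j, (A * B) i j * x j = ∑ k, A i k * ∑ j, B k j * x j := fun i => by
    have := congrFun (Matrix.mulVec_mulVec x A B) i
    exact this.symm
  simp only [h]
  exact (hA _).trans (hB x)

theorem contracts_of_orthonormal {m n : Type*} [Fintype m] [Fintype n] [DecidableEq n]
    {U : Matrix m n ℝ} (hU : Uᵀ * U = 1) : Contracts U := by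
  intro x
  rw [sum_mulVec_sq, hU, Matrix.one_mulVec]
  simp [dotProduct, sq]

theorem contracts_one_sub_projection {m n : Type*} [Fintype m] [Fintype n] [DecidableEq m]
    [DecidableEq n] {V : Matrix m n ℝ} (hV : Vᵀ * V = 1) : Contracts (1 - V * Vᵀ) := by
  intro x
  have h : (1 - V * Vᵀ)ᵀ * (1 - V * Vᵀ) = 1 - V * Vᵀ := by
    have h2 : V * Vᵀ * (V * Vᵀ) = V * Vᵀ := by
      rw [Matrix.mul_assoc, ← Matrix.mul_assoc Vᵀ, hV, Matrix.one_mul]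
    rw [Matrix.transpose_sub, Matrix.transpose_one, Matrix.transpose_mul,
      Matrix.transpose_transpose, Matrix.sub_mul, Matrix.one_mul, Matrix.mul_sub, Matrix.mul_one,
      h2, sub_self, sub_zero]
  have h3 := sum_mulVec_sq Vᵀ x
  rw [Matrix.transpose_transpose] at h3
  have h4 : 0 ≤ x ⬝ᵥ ((V * Vᵀ) *ᵥ x) := h3 ▸ sum_nonneg fun _ _ => sq_nonneg _
  rw [sum_mulVec_sq, h, Matrix.sub_mulVec, dotProduct_sub, Matrix.one_mulVec]
  have h5 : x ⬝ᵥ x = ∑ j, x j ^ 2 := by simp [dotProduct, sq]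
  linarith

/-! ### The `sin Θ` distance -/

/-- Both sides equal r − ‖UᵀV‖_F². -/
theorem sum_one_sub_singVal_sq {m r : ℕ} {V U : Matrix (Fin m) (Fin r) ℝ} (hV : Vᵀ * V = 1)
    (hU : Uᵀ * U = 1) :
    ∑ i : Fin r, (1 - singVal (Uᵀ * V) i ^ 2) = ∑ i, ∑ j, ((1 - V * Vᵀ : Matrix (Fin m) (Fin m) ℝ) * U) i j ^ 2 := by
  have h1 := sum_singVal_pow_eq_trace (Uᵀ * V) 1
  simp only [pow_one] at h1
  rw [sum_sub_distrib, h1, sum_sq_eq_trace]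
  have h2 : ((1 - V * Vᵀ) * U)ᵀ * ((1 - V * Vᵀ) * U) = 1 - (Uᵀ * V) * (Uᵀ * V)ᵀ := by
    have h3 : Vᵀ * (V * (Vᵀ * U)) = Vᵀ * U := by
      rw [← Matrix.mul_assoc, hV, Matrix.one_mul]
    simp only [Matrix.transpose_mul, Matrix.transpose_sub,
      Matrix.transpose_transpose, Matrix.mul_sub, Matrix.sub_mul, Matrix.one_mul,
      Matrix.mul_assoc, h3, hU, sub_self, sub_zero]
  rw [h2, Matrix.trace_sub, Matrix.trace_one, Matrix.trace_mul_comm]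
  simp

/-- Power means: r^(-1/q) times the ℓ_q norm is nondecreasing in q, so q = 2 is the worst case. It
is proved through convexity of the power 2/q ≥ 1. -/
theorem sinTheta_le {m r : ℕ} (hr : 1 ≤ r) {V U : Matrix (Fin m) (Fin r) ℝ} (hV : Vᵀ * V = 1)
    (hU : Uᵀ * U = 1) {q : ℝ} (hq1 : 1 ≤ q) (hq2 : q ≤ 2) :
    (r : ℝ) ^ (-(1 / q)) * sinTheta q V U
      ≤ √(∑ i, ∑ j, ((1 - V * Vᵀ : Matrix (Fin m) (Fin m) ℝ) * U) i j ^ 2) / √r := by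
  have hr0 : (0 : ℝ) < r := by exact_mod_cast hr
  have hq0 : 0 < q := by linarith
  have hA : Contracts (Uᵀ * V) :=
    (contracts_of_orthonormal hU).transpose.mul (contracts_of_orthonormal hV)
  set x : Fin r → ℝ := fun i => Real.sin (Real.arccos (singVal (Uᵀ * V) i)) with hx
  have hx0 : ∀ i, 0 ≤ x i := fun i => by
    simp only [hx, Real.sin_arccos]
    positivity
  have hx2 : ∑ i, x i ^ 2 = ∑ i, ∑ j, ((1 - V * Vᵀ : Matrix (Fin m) (Fin m) ℝ) * U) i j ^ 2 := by
    rw [← sum_one_sub_singVal_sq hV hU]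
    refine sum_congr rfl fun i _ => ?_
    simp only [hx]
    rw [Real.sin_arccos, Real.sq_sqrt]
    have h1 := hA.singVal_le_one i
    have h2 := singVal_nonneg (Uᵀ * V) i
    nlinarith
  have hsum0 : 0 ≤ ∑ i, x i ^ q := sum_nonneg fun i _ => Real.rpow_nonneg (hx0 i) q
  have hp : 1 ≤ 2 / q := by rwa [le_div_iff₀ hq0, one_mul]
  have h := Real.rpow_sum_le_const_mul_sum_rpow_of_nonneg (f := fun i => x i ^ q) univ hp
    fun i _ => Real.rpow_nonneg (hx0 i) q
  have hxx : ∀ i, (x i ^ q) ^ (2 / q) = x i ^ 2 := fun i => by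
    rw [← Real.rpow_mul (hx0 i), mul_div_cancel₀ _ hq0.ne', Real.rpow_two]
  simp only [hxx, card_univ, Fintype.card_fin] at h
  rw [← hx2, ← Real.sqrt_div' _ hr0.le]
  refine Real.le_sqrt_of_sq_le ?_
  have e1 : ((r : ℝ) ^ (-(1 / q)) * sinTheta q V U) ^ 2
      = (r : ℝ) ^ (-(2 / q)) * (∑ i, x i ^ q) ^ (2 / q) := by
    rw [sinTheta, mul_pow, ← Real.rpow_two, ← Real.rpow_two, ← Real.rpow_mul hr0.le,
      ← Real.rpow_mul hsum0]
    congr 2 <;> ring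
  rw [e1]
  calc _ ≤ (r : ℝ) ^ (-(2 / q)) * ((r : ℝ) ^ (2 / q - 1) * ∑ i, x i ^ 2) := by gcongr
    _ = (∑ i, x i ^ 2) / r := by
      rw [← mul_assoc, ← Real.rpow_add hr0, show -(2 / q) + (2 / q - 1) = (-1 : ℝ) by ring,
        Real.rpow_neg_one]
      ring

variable {Ω : Type*} [MeasurableSpace Ω] {P : Measure Ω}

theorem aemeasurable_matrix_mul {l m n : Type*} [Fintype m] {A : Ω → Matrix l m ℝ}
    {B : Ω → Matrix m n ℝ} (hA : ∀ i j, AEMeasurable (fun ω => A ω i j) P)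
    (hB : ∀ i j, AEMeasurable (fun ω => B ω i j) P) (i : l) (j : n) :
    AEMeasurable (fun ω => (A ω * B ω) i j) P := by
  simp only [Matrix.mul_apply]
  exact Finset.aemeasurable_fun_sum _ fun k _ => (hA i k).mul (hB k j)

theorem aemeasurable_matrix_pow {m : Type*} [Fintype m] [DecidableEq m] {A : Ω → Matrix m m ℝ}
    (hA : ∀ i j, AEMeasurable (fun ω => A ω i j) P) (n : ℕ) (i j : m) :
    AEMeasurable (fun ω => (A ω ^ n) i j) P := by
  induction n generalizing i j with
  | zero => simp
  | succ n ih =>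
    simp only [pow_succ]
    exact aemeasurable_matrix_mul ih hA i j

/-- Symmetric continuous functions of the singular values of a random contraction are
measurable. -/
theorem aemeasurable_sum_singVal {r : ℕ} {A : Ω → Matrix (Fin r) (Fin r) ℝ}
    (hA : ∀ i j, AEMeasurable (fun ω => A ω i j) P) (hc : ∀ᵐ ω ∂P, Contracts (A ω)) {f : ℝ → ℝ}
    (hf : Continuous f) : AEMeasurable (fun ω => ∑ i : Fin r, f (singVal (A ω) i ^ 2)) P := by
  -- Weierstrass approximation on [0, 1], where the squared singular values of a contraction lie;
  -- for polynomials the sum is a combination of traces of powers of AᵀA.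
  choose g hg using fun n : ℕ => exists_polynomial_near_of_continuousOn 0 1 f hf.continuousOn
    (1 / ((n : ℝ) + 1)) Nat.one_div_pos_of_nat
  have hmeas : ∀ n, AEMeasurable (fun ω => ∑ i : Fin r, (g n).eval (singVal (A ω) i ^ 2)) P := by
    intro n
    have : ∀ ω, ∑ i : Fin r, (g n).eval (singVal (A ω) i ^ 2)
        = ∑ k ∈ range ((g n).natDegree + 1), (g n).coeff k *
          ∑ i, (((A ω)ᵀ * A ω) ^ k) i i := by
      intro ω
      simp only [Polynomial.eval_eq_sum_range]
      rw [sum_comm]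
      refine sum_congr rfl fun k _ => ?_
      rw [← mul_sum, sum_singVal_pow_eq_trace]
      rfl
    simp only [this]
    refine Finset.aemeasurable_fun_sum _ fun k _ => AEMeasurable.const_mul ?_ _
    refine Finset.aemeasurable_fun_sum _ fun i _ => ?_
    exact aemeasurable_matrix_pow (aemeasurable_matrix_mul (fun i j => hA j i) hA) k i i
  refine aemeasurable_of_tendsto_metrizable_ae Filter.atTop hmeas ?_
  filter_upwards [hc] with ω hω
  refine tendsto_finsetSum _ fun i _ => ?_
  refine tendsto_iff_dist_tendsto_zero.2 (squeeze_zero (fun _ => dist_nonneg) (fun n => ?_)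
    tendsto_one_div_add_atTop_nhds_zero_nat)
  have h1 := hω.singVal_le_one i
  have h2 := singVal_nonneg (A ω) i
  exact (hg n _ ⟨sq_nonneg _, pow_le_one₀ h2 h1⟩).le

theorem aemeasurable_sinTheta {m r : ℕ} {V : Ω → Matrix (Fin m) (Fin r) ℝ}
    {U : Matrix (Fin m) (Fin r) ℝ} (hV : ∀ i j, AEMeasurable (fun ω => V ω i j) P)
    (hVo : ∀ᵐ ω ∂P, (V ω)ᵀ * V ω = 1) (hU : Uᵀ * U = 1) {q : ℝ} (hq : 1 ≤ q) :
    AEMeasurable (fun ω => sinTheta q (V ω) U) P := by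
  have h : ∀ ω, sinTheta q (V ω) U = (∑ i : Fin r, (fun x => Real.sin (Real.arccos √x) ^ q)
      (singVal (Uᵀ * V ω) i ^ 2)) ^ (1 / q) := fun ω => by
    simp only [sinTheta, Real.sqrt_sq (singVal_nonneg _ _)]
  simp only [h]
  refine AEMeasurable.pow_const (aemeasurable_sum_singVal (A := fun ω => Uᵀ * V ω)
    (f := fun x => Real.sin (Real.arccos √x) ^ q)
    (aemeasurable_matrix_mul (A := fun _ => Uᵀ) (fun _ _ => aemeasurable_const) hV) ?_ ?_) _
  · filter_upwards [hVo] with ω hω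
    exact (contracts_of_orthonormal hU).transpose.mul (contracts_of_orthonormal hω)
  · exact (Real.continuous_sin.comp (Real.continuous_arccos.comp Real.continuous_sqrt)).rpow_const
      fun _ => Or.inr (by linarith)

variable {r : Fin 3 → ℕ}

/-! ### Signal strength -/

theorem signal_le (r : Fin 3 → ℕ) (X : Tensor p) (k : Fin 3) :
    signal r X ≤ singVal (matricize k X) (r k - 1) := by
  fin_cases k
  · exact min_le_left _ _
  · exact (min_le_right _ _).trans (min_le_left _ _)
  · exact (min_le_right _ _).trans (min_le_right _ _)

/-- Used with Q = 1 to bound ‖X‖ below, and with Q = 1 − V_kV_kᵀ to bound the angles. -/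
theorem signal_sq_mul_sum_sq_le {S : Tensor r} {U : Factors p r} (hU : Orthonormals U)
    (hpos : 0 < signal r (mulModes S U)) (k : Fin 3) {a : Type*} [Fintype a]
    (Q : Matrix a (Fin (p k)) ℝ) :
    signal r (mulModes S U) ^ 2 * ∑ i, ∑ j, (Q * U k) i j ^ 2
      ≤ ∑ i, ∑ c, (Q * matricize k (mulModes S U)) i c ^ 2 := by
  have hle := signal_le r (mulModes S U) k
  rw [matricize_mulModes] at hle ⊢
  have h := singVal_sq_mul_sum_sq_le (hU k) _ (hpos.trans_le hle) (Q * U k)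
  rw [Matrix.mul_assoc] at h
  refine le_trans ?_ h
  refine mul_le_mul_of_nonneg_right ?_ (sum_nonneg fun _ _ => sum_nonneg fun _ _ => sq_nonneg _)
  exact pow_le_pow_left₀ hpos.le hle 2

theorem signal_sq_mul_le_frob_sq {S : Tensor r} {U : Factors p r} (hU : Orthonormals U)
    (hpos : 0 < signal r (mulModes S U)) (k : Fin 3) :
    signal r (mulModes S U) ^ 2 * r k ≤ frob (mulModes S U) ^ 2 := by
  have h := signal_sq_mul_sum_sq_le hU hpos k (1 : Matrix (Fin (p k)) (Fin (p k)) ℝ)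
  rw [Matrix.one_mul, Matrix.one_mul, sum_matricize_sq, sum_sq_eq_trace, hU k] at h
  simpa using h

/-- The complementary projection kills the matricization of the projected tensor, so on the signal
it sees only the error, which it does not enlarge. -/
theorem signal_mul_sinTheta_le {S : Tensor r} {U V : Factors p r} (hU : Orthonormals U)
    (hV : Orthonormals V) (hpos : 0 < signal r (mulModes S U)) (Y : Tensor p) (k : Fin 3)
    (hr : 1 ≤ r k) {q : ℝ} (hq1 : 1 ≤ q) (hq2 : q ≤ 2) :
    (r k : ℝ) ^ (-(1 / q)) * sinTheta q (V k) (U k)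
      ≤ frob (projectTensor Y V - mulModes S U) / (signal r (mulModes S U) * √(r k)) := by
  set X := mulModes S U with hX
  have hr0 : (0 : ℝ) < r k := by exact_mod_cast hr
  refine (sinTheta_le hr (hV k) (hU k) hq1 hq2).trans ?_
  rw [← div_div]
  refine div_le_div_of_nonneg_right ?_ (Real.sqrt_nonneg _)
  rw [le_div_iff₀ hpos]
  refine le_of_sq_le_sq ?_ (frob_nonneg _)
  rw [mul_pow, Real.sq_sqrt ?nonneg, mul_comm]
  case nonneg => exact sum_nonneg fun _ _ => sum_nonneg fun _ _ => sq_nonneg _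
  refine (signal_sq_mul_sum_sq_le hU hpos k _).trans ?_
  have h0 : (1 - V k * (V k)ᵀ) * matricize k (projectTensor Y V) = 0 := by
    rw [projectTensor, matricize_mulModes, ← Matrix.mul_assoc, Matrix.sub_mul, Matrix.one_mul,
      Matrix.mul_assoc, ← Matrix.mul_assoc (V k)ᵀ, hV k, Matrix.one_mul, sub_self, Matrix.zero_mul]
  have h1 : (1 - V k * (V k)ᵀ) * matricize k X
      = -((1 - V k * (V k)ᵀ) * matricize k (projectTensor Y V - X)) := by
    rw [matricize_sub, Matrix.mul_sub, h0, zero_sub, neg_neg]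
  rw [← hX, h1]
  simp only [Matrix.neg_apply, neg_sq]
  rw [← sum_matricize_sq k]
  exact (contracts_one_sub_projection (hV k)).sum_mul_sq_le _

/-! ### Bounds in expectation -/

section Expectation

theorem aemeasurable_frob_projectTensor_sub_sq {Y : Ω → Tensor p} {V : Ω → Factors p r}
    (hY : ∀ i, AEMeasurable (fun ω => Y ω i) P)
    (hV : ∀ k a b, AEMeasurable (fun ω => V ω k a b) P) (X : Tensor p) :
    AEMeasurable (fun ω => frob (projectTensor (Y ω) (V ω) - X) ^ 2) P := by
  have h : ∀ ω, frob (projectTensor (Y ω) (V ω) - X) ^ 2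
      = ∑ i, (projectTensor (Y ω) (V ω) i - X i) ^ 2 := fun ω => by
    rw [frob, Real.sq_sqrt (sum_nonneg fun _ _ => sq_nonneg _)]
    rfl
  rw [funext h]
  simp only [projectTensor, mulModes]
  refine Finset.aemeasurable_fun_sum _ fun i _ => AEMeasurable.pow_const (AEMeasurable.sub_const
    (Finset.aemeasurable_fun_sum _ fun i' _ => (hY i').mul
      (Finset.aemeasurable_fun_prod _ fun k _ => ?_)) _) _
  exact aemeasurable_matrix_mul (hV k) (fun a b => hV k b a) _ _

variable [IsProbabilityMeasure P]

/-- The constant in the bound on the mean squared error. -/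
noncomputable def mseConst (C₀ : ℝ) : ℝ := 4096 * (32 * C₀ ^ 2 + 10)

/-- The dominating variable Ψ is chosen before the estimator, so one integrable bound serves every
maximizer. -/
theorem exists_integrable_frob_sq_bound {C₀ σ : ℝ} (hσ : 0 < σ)
    (hr : ∀ k, 1 ≤ r k ∧ r k ≤ p k) (hrp : ∀ k, (r k : ℝ) ≤ C₀ * √(minOf p : ℝ))
    {Z : (∀ k, Fin (p k)) → Ω → ℝ} (hind : iIndepFun Z P)
    (hlaw : ∀ i, HasLaw (Z i) (gaussianReal 0 (Real.toNNReal (σ ^ 2))) P)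
    {U : Factors p r} (hU : Orthonormals U) (S : Tensor r) :
    ∃ Ψ : Ω → ℝ, Integrable Ψ P ∧
      ∫ ω, Ψ ω ∂P ≤ mseConst C₀ * σ ^ 2 * ∑ k, (p k : ℝ) * (r k : ℝ) ∧
      ∀ (ω : Ω) (V : Factors p r), IsMLE (mulModes S U + fun i => Z i ω) V →
        frob (projectTensor (mulModes S U + fun i => Z i ω) V - mulModes S U) ^ 2 ≤ Ψ ω := by
  obtain ⟨N, hN, hN1, hcard, hnet⟩ := exists_tensor_net p fun k => 2 * r k
  obtain ⟨Φ, hΦ, hΦle, hΦmax⟩ := exists_integrable_sq_bound hσ hind hlaw hN fun T hT => by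
    have h := pow_le_one₀ (n := 2) (frob_nonneg T) (hN1 T hT)
    rwa [frob, Real.sq_sqrt (sum_nonneg fun _ _ => sq_nonneg _)] at h
  set R : ℝ := ∑ k, (p k : ℝ) * (r k : ℝ) with hR
  -- 1024 = (2 · 16)²: the 2 comes from the basic inequality, the 16 from the net.
  refine ⟨fun ω => 1024 * Φ ω, hΦ.const_mul _, ?_, ?_⟩
  · have hp1 : ∀ k, (1 : ℝ) ≤ p k := fun k => by exact_mod_cast (hr k).1.trans (hr k).2
    have hr1 : ∀ k, (1 : ℝ) ≤ r k := fun k => by exact_mod_cast (hr k).1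
    have hR0 : (p 0 : ℝ) * r 0 ≤ R :=
      single_le_sum (f := fun k => (p k : ℝ) * (r k : ℝ)) (fun k _ => by positivity) (mem_univ 0)
    have hR1 : 1 ≤ R := le_trans (by nlinarith [hp1 0, hr1 0]) hR0
    -- Here r_k ≤ C₀√p is needed: two of the ranks multiply to at most C₀²p.
    have hcore : (r 0 : ℝ) * r 1 * r 2 ≤ C₀ ^ 2 * R := by
      have h12 : (r 1 : ℝ) * r 2 ≤ C₀ ^ 2 * minOf p := by
        have := mul_le_mul (hrp 1) (hrp 2) (by positivity) ((Nat.cast_nonneg _).trans (hrp 1))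
        rwa [mul_mul_mul_comm, ← sq, Real.mul_self_sqrt (Nat.cast_nonneg _)] at this
      have hmin : (minOf p : ℝ) ≤ p 0 := by exact_mod_cast min_le_left _ _
      calc (r 0 : ℝ) * r 1 * r 2 = r 0 * (r 1 * r 2) := mul_assoc _ _ _
        _ ≤ r 0 * (C₀ ^ 2 * p 0) := mul_le_mul_of_nonneg_left
            (h12.trans (by gcongr)) (Nat.cast_nonneg _)
        _ = C₀ ^ 2 * (p 0 * r 0) := by ring
        _ ≤ C₀ ^ 2 * R := by gcongr
    have hlog : Real.log N.card ≤ (8 * (C₀ ^ 2 * R) + 2 * R) * 4 := by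
      have hNpos : (0 : ℝ) < N.card := by exact_mod_cast hN.card_pos
      have h1 : (N.card : ℝ) ≤ 5 ^ (∏ k, 2 * r k + ∑ k, p k * (2 * r k)) := by exact_mod_cast hcard
      have h2 := Real.log_le_log hNpos h1
      rw [Real.log_pow] at h2
      have h3 : Real.log 5 ≤ 4 := by
        have := Real.log_le_sub_one_of_pos (show (0 : ℝ) < 5 by norm_num)
        linarith
      refine h2.trans (mul_le_mul ?_ h3 (Real.log_nonneg (by norm_num)) (by positivity))
      push_cast
      have h4 : ∑ k, (p k : ℝ) * (2 * r k) = 2 * R := by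
        rw [hR, mul_sum]
        exact sum_congr rfl fun _ _ => by ring
      rw [h4, Fin.prod_univ_three]
      linarith
    rw [integral_const_mul, mseConst]
    calc _ ≤ 1024 * (4 * σ ^ 2 * ((8 * (C₀ ^ 2 * R) + 2 * R) * 4 + 2 * R)) := by
          gcongr
          refine hΦle.trans ?_
          gcongr
          linarith
      _ = _ := by ring
  · intro ω V hV
    have hΦ0 : 0 ≤ Φ ω := (sq_nonneg _).trans (hΦmax ω _ hN.choose_spec)
    have h := hV.frob_projectTensor_sub_le hU (B := 16 * √(Φ ω)) fun G W hG hW =>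
      hnet _ _ (fun T hT => Real.abs_le_sqrt (hΦmax ω T hT)) G W hG hW
    have h2 := pow_le_pow_left₀ (frob_nonneg _) h 2
    rw [mul_pow, mul_pow, Real.sq_sqrt hΦ0] at h2
    linarith

/-- Integrates 2√a·f ≤ f² + a. -/
theorem integral_le_sqrt_of_integral_sq_le {f : Ω → ℝ} {a : ℝ} (ha : 0 < a) (hf : Integrable f P)
    (hf2 : Integrable (fun ω => f ω ^ 2) P) (h : ∫ ω, f ω ^ 2 ∂P ≤ a) : ∫ ω, f ω ∂P ≤ √a := by
  have hs : 0 < √a := Real.sqrt_pos.2 ha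
  have hle : ∀ ω, 2 * √a * f ω ≤ f ω ^ 2 + a := fun ω => by
    nlinarith [sq_nonneg (f ω - √a), Real.sq_sqrt ha.le]
  have h1 := integral_mono (hf.const_mul _) (hf2.add (integrable_const a)) hle
  rw [integral_const_mul] at h1
  have h2 : ∫ ω, f ω ^ 2 + a ∂P = (∫ ω, f ω ^ 2 ∂P) + a := by
    rw [integral_add hf2 (integrable_const a)]
    simp
  have h3 := h1.trans_eq h2
  nlinarith [Real.mul_self_sqrt ha.le]

end Expectation

end TensorSVD

/-! ### The three risk bounds -/

theorem theorem2 (C₀ c₀ : ℝ) (hC₀ : 0 < C₀) (hc₀ : 0 < c₀) :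
    ∃ Cgap : ℝ, 0 < Cgap ∧ ∃ C : ℝ, 0 < C ∧
      ∀ (p r : Fin 3 → ℕ),
        (∀ k, 1 ≤ r k ∧ r k ≤ p k) →
        (∀ k, (p k : ℝ) ≤ C₀ * (minOf p : ℝ)) →
        (∀ k, (r k : ℝ) ≤ C₀ * √(minOf p : ℝ)) →
        (maxOf r : ℝ) ≤ C₀ * (minOf r : ℝ) →
      ∀ (σ : ℝ), 0 < σ →
      ∀ (S : Tensor r) (U : Factors p r) (X : Tensor p) (lam : ℝ),
        Orthonormals U →
        X = mulModes S U →
        lam = signal r X →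
        frob X ≤ C₀ * σ * Real.exp (c₀ * (minOf p : ℝ)) →
        Cgap * √(minOf p : ℝ) ≤ lam / σ →
      ∀ (Ω : Type*) [MeasurableSpace Ω] (P : Measure Ω) [IsProbabilityMeasure P]
        (Z : (∀ k, Fin (p k)) → Ω → ℝ),
        iIndepFun Z P →
        (∀ i, HasLaw (Z i) (gaussianReal 0 (Real.toNNReal (σ ^ 2))) P) →
      ∀ (Y : Ω → Tensor p) (Uhat : Ω → Factors p r) (Xhat : Ω → Tensor p),
        (∀ ω i, Y ω i = X i + Z i ω) →
        (∀ k a b, AEMeasurable (fun ω => Uhat ω k a b) P) →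
        (∀ᵐ ω ∂P, IsMLE (Y ω) (Uhat ω)) →
        (∀ ω, Xhat ω = projectTensor (Y ω) (Uhat ω)) →
        (∀ k, ∀ q : ℝ, 1 ≤ q → q ≤ 2 →
          Integrable (fun ω => (r k : ℝ) ^ (-(1 / q)) * sinTheta q (Uhat ω k) (U k)) P ∧
          ∫ ω, (r k : ℝ) ^ (-(1 / q)) * sinTheta q (Uhat ω k) (U k) ∂P
            ≤ C * √(p k : ℝ) / (lam / σ)) ∧
        (Integrable (fun ω => frob (Xhat ω - X) ^ 2) P ∧
          ∫ ω, frob (Xhat ω - X) ^ 2 ∂P ≤ C * σ ^ 2 * ∑ k, (p k : ℝ) * (r k : ℝ)) ∧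
        (Integrable (fun ω => frob (Xhat ω - X) ^ 2 / frob X ^ 2) P ∧
          ∫ ω, frob (Xhat ω - X) ^ 2 / frob X ^ 2 ∂P
            ≤ C * min ((∑ k, (p k : ℝ)) / (lam ^ 2 / σ ^ 2)) 1) := by
  have hM : 0 < mseConst C₀ := by
    unfold mseConst
    positivity
  -- With M = `mseConst C₀`, the constant must dominate M for the squared error, 3C₀M for the cap by
  -- 1, and √(3MC₀²) ≤ 1 + 3MC₀² for the angles.
  refine ⟨1, one_pos, mseConst C₀ * (1 + 3 * C₀) + (1 + 3 * mseConst C₀ * C₀ ^ 2),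
    by positivity, ?_⟩
  set M := mseConst C₀
  set C := M * (1 + 3 * C₀) + (1 + 3 * M * C₀ ^ 2) with hC
  intro p r hr hpp hrp hrr σ hσ S U X lam hU hX hlam _ hgap Ω _ P _ Z hind hlaw Y Uhat Xhat hY
    hmeas hmle hXhat
  have hp0 : ∀ k, (0 : ℝ) < p k := fun k => by exact_mod_cast (hr k).1.trans (hr k).2
  have hr0 : ∀ k, (0 : ℝ) < r k := fun k => by exact_mod_cast (hr k).1
  have hminp : ∀ k, (minOf p : ℝ) ≤ p k := fun k => by
    have : minOf p ≤ p k := by fin_cases k <;> simp [minOf]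
    exact_mod_cast this
  have hminp0 : (0 : ℝ) < minOf p := by
    have h : ∀ k, 0 < p k := fun k => by exact_mod_cast hp0 k
    have : 0 < minOf p := by simp [minOf, h]
    exact_mod_cast this
  have hminr : ∀ k, (minOf r : ℝ) ≤ r k := fun k => by
    have : minOf r ≤ r k := by fin_cases k <;> simp [minOf]
    exact_mod_cast this
  have hmaxr : ∀ k, (r k : ℝ) ≤ maxOf r := fun k => by
    have : r k ≤ maxOf r := by fin_cases k <;> simp [maxOf]
    exact_mod_cast this
  rw [one_mul] at hgap
  have hlamσ : 0 < lam / σ := (Real.sqrt_pos.2 hminp0).trans_le hgap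
  have hlam0 : 0 < lam := by
    have := mul_pos hlamσ hσ
    rwa [div_mul_cancel₀ _ hσ.ne'] at this
  subst hX
  have hYeq : ∀ ω, Y ω = mulModes S U + fun i => Z i ω := fun ω => funext fun i => hY ω i
  obtain ⟨Ψ, hΨ, hΨle, hΨb⟩ := exists_integrable_frob_sq_bound hσ hr hrp hind hlaw hU S
  set R : ℝ := ∑ k, (p k : ℝ) * (r k : ℝ) with hR
  have hR0 : 0 < R := Finset.sum_pos (fun k _ => mul_pos (hp0 k) (hr0 k)) Finset.univ_nonempty
  set X := mulModes S U
  have hD : ∀ᵐ ω ∂P, frob (Xhat ω - X) ^ 2 ≤ Ψ ω := by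
    filter_upwards [hmle] with ω hω
    rw [hXhat, hYeq]
    rw [hYeq] at hω
    exact hΨb ω _ hω
  have hDmeas : AEMeasurable (fun ω => frob (Xhat ω - X) ^ 2) P := by
    simp only [hXhat]
    refine aemeasurable_frob_projectTensor_sub_sq (fun i => ?_) hmeas X
    simp only [hY]
    exact (hlaw i).aemeasurable.const_add _
  have hDint : Integrable (fun ω => frob (Xhat ω - X) ^ 2) P := by
    refine hΨ.mono' hDmeas.aestronglyMeasurable ?_
    filter_upwards [hD] with ω hω
    rwa [Real.norm_of_nonneg (sq_nonneg _)]
  have hmse : ∫ ω, frob (Xhat ω - X) ^ 2 ∂P ≤ M * σ ^ 2 * R :=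
    (integral_mono_ae hDint hΨ hD).trans hΨle
  have hD1meas : AEMeasurable (fun ω => frob (Xhat ω - X)) P := by
    have : ∀ ω, frob (Xhat ω - X) = √(frob (Xhat ω - X) ^ 2) := fun ω =>
      (Real.sqrt_sq (frob_nonneg _)).symm
    rw [funext this]
    exact hDmeas.sqrt
  have hD1int : Integrable (fun ω => frob (Xhat ω - X)) P := by
    refine (hDint.add (integrable_const 1)).mono' hD1meas.aestronglyMeasurable
      (ae_of_all _ fun ω => ?_)
    rw [Real.norm_of_nonneg (frob_nonneg _)]
    simp only [Pi.add_apply]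
    nlinarith [sq_nonneg (frob (Xhat ω - X) - 1), frob_nonneg (Xhat ω - X)]
  have hD1 : ∫ ω, frob (Xhat ω - X) ∂P ≤ √(M * σ ^ 2 * R) :=
    integral_le_sqrt_of_integral_sq_le (by positivity) hD1int hDint hmse
  have hMC : M ≤ C := by
    rw [hC]
    nlinarith [mul_pos hM hC₀, mul_pos hM (pow_pos hC₀ 2)]
  refine ⟨fun k q hq1 hq2 => ?_, ⟨hDint, hmse.trans (by gcongr)⟩, hDint.div_const _, ?_⟩
  · have hbound : ∀ᵐ ω ∂P, (r k : ℝ) ^ (-(1 / q)) * sinTheta q (Uhat ω k) (U k)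
        ≤ frob (Xhat ω - X) / (lam * √(r k)) := by
      filter_upwards [hmle] with ω hω
      rw [hXhat, hlam]
      exact signal_mul_sinTheta_le hU hω.1 (hlam ▸ hlam0) (Y ω) k (hr k).1 hq1 hq2
    have hnn : ∀ ω, 0 ≤ (r k : ℝ) ^ (-(1 / q)) * sinTheta q (Uhat ω k) (U k) := fun ω => by
      refine mul_nonneg (by positivity) (Real.rpow_nonneg (Finset.sum_nonneg fun i _ => ?_) _)
      rw [Real.sin_arccos]
      positivity
    have hsmeas : AEMeasurable (fun ω => (r k : ℝ) ^ (-(1 / q)) *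
        sinTheta q (Uhat ω k) (U k)) P :=
      (aemeasurable_sinTheta (hmeas k) (hmle.mono fun ω hω => hω.1 k) (hU k) hq1).const_mul _
    have hbint : Integrable (fun ω => frob (Xhat ω - X) / (lam * √(r k))) P :=
      hD1int.div_const _
    have hsint : Integrable (fun ω => (r k : ℝ) ^ (-(1 / q)) *
        sinTheta q (Uhat ω k) (U k)) P := by
      refine hbint.mono' hsmeas.aestronglyMeasurable ?_
      filter_upwards [hbound] with ω hω
      rwa [Real.norm_of_nonneg (hnn ω)]
    refine ⟨hsint, (integral_mono_ae hsint hbint hbound).trans ?_⟩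
    rw [integral_div]
    -- Comparable dimensions and comparable ranks let the single mode k stand for the sum over all
    -- three.
    have hRle : R ≤ 3 * C₀ ^ 2 * (p k * r k) := by
      have h1 : ∀ j ∈ (Finset.univ : Finset (Fin 3)), (p j : ℝ) * r j ≤ C₀ ^ 2 * (p k * r k) := by
        intro j _
        have hpj : (p j : ℝ) ≤ C₀ * p k := (hpp j).trans (mul_le_mul_of_nonneg_left (hminp k) hC₀.le)
        have hrj : (r j : ℝ) ≤ C₀ * r k :=
          (hmaxr j).trans (hrr.trans (mul_le_mul_of_nonneg_left (hminr k) hC₀.le))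
        calc (p j : ℝ) * r j ≤ (C₀ * p k) * (C₀ * r k) := by gcongr
          _ = _ := by ring
      have h2 := Finset.sum_le_card_nsmul _ _ _ h1
      simp only [Finset.card_univ, Fintype.card_fin, nsmul_eq_mul] at h2
      push_cast at h2
      linarith
    have hC3 : √(3 * M * C₀ ^ 2) ≤ C := by
      have h1 : √(3 * M * C₀ ^ 2) ≤ 1 + 3 * M * C₀ ^ 2 := by
        refine Real.sqrt_le_iff.2 ⟨by positivity, ?_⟩
        nlinarith [mul_pos hM (pow_pos hC₀ 2)]
      have h2 : 0 < M * (1 + 3 * C₀) := by positivity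
      linarith
    have hsq : √(M * σ ^ 2 * R) ≤ C * σ * √(p k) * √(r k) := by
      calc √(M * σ ^ 2 * R) ≤ √(3 * M * C₀ ^ 2 * (σ ^ 2 * (p k * r k))) := by
            refine Real.sqrt_le_sqrt ?_
            calc M * σ ^ 2 * R ≤ M * σ ^ 2 * (3 * C₀ ^ 2 * (p k * r k)) := by gcongr
              _ = _ := by ring
        _ = √(3 * M * C₀ ^ 2) * (σ * (√(p k) * √(r k))) := by
            rw [Real.sqrt_mul (by positivity) (σ ^ 2 * _), Real.sqrt_mul (by positivity) (_ * _),
              Real.sqrt_sq hσ.le, Real.sqrt_mul (by positivity) (r k : ℝ)]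
        _ ≤ C * (σ * (√(p k) * √(r k))) := by gcongr
        _ = _ := by ring
    have hsr : 0 < √(r k : ℝ) := Real.sqrt_pos.2 (hr0 k)
    calc _ ≤ (C * σ * √(p k) * √(r k)) / (lam * √(r k)) := by
          gcongr
          exact hD1.trans hsq
      _ = C * √(p k) / (lam / σ) := by
          field_simp
  · rw [integral_div]
    have hXr : ∀ k, lam ^ 2 * r k ≤ frob X ^ 2 := fun k => by
      rw [hlam]
      exact signal_sq_mul_le_frob_sq hU (hlam ▸ hlam0) k
    have hX0 : 0 < frob X ^ 2 := lt_of_lt_of_le (by have := hr0 0; positivity) (hXr 0)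
    set s : ℝ := ∑ k, (p k : ℝ) with hs
    have hs0 : 0 < s := Finset.sum_pos (fun k _ => hp0 k) Finset.univ_nonempty
    -- The bound λ²r_k ≤ ‖X‖², weighted by p_k and summed over the modes.
    have hRs : lam ^ 2 * R ≤ s * frob X ^ 2 := by
      rw [hR, hs, Finset.mul_sum, Finset.sum_mul]
      refine Finset.sum_le_sum fun k _ => ?_
      calc lam ^ 2 * ((p k : ℝ) * r k) = p k * (lam ^ 2 * r k) := by ring
        _ ≤ _ := by gcongr; exact hXr k
    have h1 : (∫ ω, frob (Xhat ω - X) ^ 2 ∂P) / frob X ^ 2 ≤ M * (s / (lam ^ 2 / σ ^ 2)) := by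
      rw [div_le_iff₀ hX0]
      calc _ ≤ M * σ ^ 2 * R := hmse
        _ = M * σ ^ 2 / lam ^ 2 * (lam ^ 2 * R) := by field_simp
        _ ≤ M * σ ^ 2 / lam ^ 2 * (s * frob X ^ 2) := by gcongr
        _ = _ := by field_simp
    -- The gap condition bounds the first term of the minimum by a constant, so the cap by 1 costs
    -- only a factor.
    have h2 : s / (lam ^ 2 / σ ^ 2) ≤ 3 * C₀ := by
      have h3 : (minOf p : ℝ) ≤ lam ^ 2 / σ ^ 2 := by
        rw [← div_pow, ← Real.sq_sqrt hminp0.le]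
        gcongr
      have h4 : s ≤ 3 * C₀ * minOf p := by
        rw [hs, Fin.sum_univ_three]
        linarith [hpp 0, hpp 1, hpp 2]
      rw [div_le_iff₀ (by positivity)]
      exact h4.trans (by gcongr)
    refine h1.trans ?_
    rw [mul_min_of_nonneg _ _ (hM.le.trans hMC)]
    refine le_min (by gcongr) ?_
    rw [mul_one]
    calc M * (s / (lam ^ 2 / σ ^ 2)) ≤ M * (3 * C₀) := by gcongr
      _ ≤ C := by
        rw [hC]
        nlinarith [mul_pos hM (pow_pos hC₀ 2)]
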